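/- **Game and beliefs.** Let $I$ be a finite non-empty set of players, let each player $i$ have a finite non-empty action set $A_i$ and a payoff $u_i:A=\prod_j A_j\to\mathbb R$, and let $\Delta_i$ be the set of mixed strategies of $i$. Write $A_{-i}=\prod_{j\ne i}A_j$ and let $U_i$ be the expected payoff under independent mixing. For $M\in\mathbb N_+$ let $\Delta_j^M$ be the set of mixed strategies of $j$ whose probabilities lie in $\{m/M: m=0,\dots,M\}$. A belief of player $i$ is $b_i=(b_{ij})_{j\ne i}\in\mathcal B_i=\prod_{j\neq i}\Delta_j^M$. For $\sigma>0$ the smooth best response is $\mathrm{Br}_i^\sigma(a_i\mid b_i)\propto e^{U_i(a_i,b_i)/\sigma}$. For profiles $p=(p_j)_{j\ne i}$, $q=(q_j)_{j\neq i}$ of opponents' strategies put $\|p-q\|_2=\bigl(\sum_{j\ne i}\sum_{a_j\in A_j}(p_j(a_j)-q_j(a_j))^2\bigr)^{1/2}$. States are the pairs $z=(b,\pi)$ with $b_i\in\mathcal B_i$ and $\pi_i=\mathrm{Br}_i^\sigma(b_i)$ for all $i$. For $\tau>0$, a state is consistent if $\|b_i-\pi_{-i}\|_2\le\tau$ for all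 $i$; let $\mathcal Z^\dagger$ be the set of consistent states. **Dynamics.** Fix $\gamma_i\in(0,1]$; non-decreasing $f_i:\mathbb R\to\mathbb R_{>0}$; a number $\bar u$ with $\bar u>\sum_i f_i(U_i(\pi))$ for every mixed profile $\pi$; resampling probabilities $\psi_i(b_i'\mid b_i)\ge\lambda>0$ with $\sum_{b'_i}\psi_i(b_i'\mid b_i)=1$; and sample sizes $T(\alpha)\in\mathbb N$, $\alpha\in(0,1)$, with $$T(\alpha)\ge \frac{2|A_{-i}|}{(\|\pi_{-i}-b_i\|_2-\tau)^2}\ln\frac2\alpha$$ for all $i$, all $b_i\in\mathcal B_i$ and all profiles $\pi_{-i}$ of smooth best responses to beliefs with $\|\pi_{-i}-b_i\|_2>\tau$. For $\xi\in(0,1)$ let $\alpha=\xi^{\bar u}$, $T=T(\alpha)$. In one epoch starting from $z=(b,\pi)$, $T$ independent action profiles are drawn from $\pi$ and observed by all players. Let $\hat\pi_{-i}=(\hat\pi_j)_{j\ne i}$ be the observed action frequencies of the opponents of $i$. Given the observations, the players act independently. Player $i$ conducts a test with probability $\gamma_i$. If the test is conducted and $\|\hat\pi_{-i}-b_i\|_2>\tau+\sqrt{\tfrac{|A_{-i}|}{2T}\ln\tfrac2\alpha}$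 (rejection), a new belief is drawn from $\psi_i(\cdot\mid b_i)$. If it is conducted and does not reject, a new belief is drawn from $\psi_i(\cdot\mid b_i)$ with probability $\xi^{f_i(U_i(\pi_i,b_i))}$. In all other cases the belief is kept. The new strategies are the smooth best responses to the new beliefs. Let $P^\xi$ be the resulting transition matrix on the states, and $\mu^\xi$ its stationary distribution. A state $z$ is stochastically stable if $\lim_{\xi\to0^+}\mu^\xi_z>0$. **Theorem 1.** Let $\epsilon>0$, and write $\|u\|=\max_{i,a}|u_i(a)|$, $m=\max_i|A_i|$, $w=\max_i|A_i||A_{-i}|$. Assume 1. $\displaystyle \sigma\le\frac{\epsilon}{2\log m},\qquad \tau\le\frac{\epsilon\,\sigma}{2\sqrt{|A|}\,\|u\|\,w},\qquad M\ge\frac{|I|\,m}{\tau}\Bigl(1+\frac{\sqrt m}{\sigma}\,\|u\|\,w\,|I|\Bigr)$, where a bound with denominator $0$ is void; 2. for every $i$ and all beliefs $b_j\in\mathcal B_j$ ($j\ne i$), with $\pi_j=\mathrm{Br}^\sigma_j(b_j)$, there is $\tilde b_i\in\mathcal B_i$ such that $\|\tilde b_i-\pi_{-i}\|_2>\tau$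 and $\|\mathrm{Br}_i^\sigma(\tilde b_i)-b_{ji}\|_2>\tau$ for all $j\ne i$. Then for every $\xi\in(0,1)$ the stationary distribution $\mu^\xi$ exists and is unique, $\lim_{\xi\to0^+}\mu_z^\xi$ exists for every state $z$, and the set of stochastically stable states is $$\mathcal Z^*=\Bigl\{(b,\pi)\in\mathcal Z^\dagger:\ \min_{i}f_i(U_i(\pi_i,b_i))=\max_{(b',\pi')\in\mathcal Z^\dagger}\min_{i}f_i(U_i(\pi'_i,b'_i))\Bigr\}.$$ If moreover $2\sqrt{|A|}\,\|u\|^2\,w\,\tau\le\epsilon\,\sigma$ (automatic when $\|u\|\le1$), then for every $(b,\pi)\in\mathcal Z^*$ the profile $\pi$ is an $\epsilon$-Nash equilibrium. -/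

import Mathlib

open Set Filter Topology

noncomputable section

namespace HypothesisLearning

/-! ### Discretized beliefs -/

/-- The discretized probability simplex with granularity `M` over a finite set of actions: all
probability vectors whose entries are of the form `m / M`, `m = 0, …, M`. -/
def gridSimplex (α : Type*) [Fintype α] (M : ℕ) : Set (α → ℝ) :=
  {p | (∀ c, 0 ≤ p c) ∧ ∑ c, p c = 1 ∧ ∀ c, ∃ m : ℕ, m ≤ M ∧ p c = (m : ℝ) / (M : ℝ)}

theorem gridSimplex_finite (α : Type*) [Fintype α] (M : ℕ) : (gridSimplex α M).Finite := by
  have h : (Set.pi (Set.univ : Set α)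
      (fun _ => (fun m : ℕ => (m : ℝ) / (M : ℝ)) '' Set.Iic M)).Finite :=
    Set.Finite.pi (fun _ => (Set.finite_Iic M).image _)
  refine h.subset ?_
  rintro p ⟨-, -, hp⟩ c -
  obtain ⟨m, hm, e⟩ := hp c
  exact ⟨m, hm, e.symm⟩

instance (α : Type*) [Fintype α] (M : ℕ) : Finite (gridSimplex α M) :=
  (gridSimplex_finite α M).to_subtype

instance (α : Type*) [Fintype α] (M : ℕ) : Fintype (gridSimplex α M) :=
  Fintype.ofFinite _

variable {I : Type*} [Fintype I] [DecidableEq I]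
variable {A : I → Type*} [∀ i, Fintype (A i)] [∀ i, DecidableEq (A i)]

/-- The belief space of player `i`: one discretized mixed strategy `b_ij` for each opponent
`j ≠ i`. -/
abbrev Belief (A : I → Type*) [∀ i, Fintype (A i)] (M : ℕ) (i : I) : Type _ :=
  ∀ j : {j : I // j ≠ i}, gridSimplex (A j) M

/-- The belief `b_i`, read as a profile of mixed strategies of the opponents. -/
def Belief.prof {M : ℕ} {i : I} (b : Belief A M i) : ∀ j : {j : I // j ≠ i}, A j → ℝ :=
  fun j => (b j : A j → ℝ)

/-! ### Utilities, smooth best response, approximate equilibrium -/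

/-- `U_i(π)`: the expected payoff of player `i` when the actions are drawn independently
from `π`. -/
def utility (u : I → (∀ j, A j) → ℝ) (i : I) (π : ∀ j, A j → ℝ) : ℝ :=
  ∑ a : ∀ j, A j, (∏ j, π j (a j)) * u i a

/-- `U_i(p, q)`: the expected payoff of player `i` who plays the mixed strategy `p` against the
opponents' profile `q`. -/
def utilityAgainst (u : I → (∀ j, A j) → ℝ) (i : I) (p : A i → ℝ)
    (q : ∀ j : {j : I // j ≠ i}, A j → ℝ) : ℝ :=
  utility u i ((Equiv.piSplitAt i (fun j => A j → ℝ)).symm (p, q))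

/-- `U_i(c, q)`: the expected payoff of player `i` from the pure action `c` against the opponents'
profile `q`. -/
def utilityAction (u : I → (∀ j, A j) → ℝ) (i : I) (c : A i)
    (q : ∀ j : {j : I // j ≠ i}, A j → ℝ) : ℝ :=
  ∑ a : ∀ j : {j : I // j ≠ i}, A j, u i ((Equiv.piSplitAt i A).symm (c, a)) * ∏ j, q j (a j)

/-- The smooth (logit) best response of player `i` with temperature `σ`. -/
def smoothBR (u : I → (∀ j, A j) → ℝ) (σ : ℝ) {M : ℕ} (i : I) (b : Belief A M i) : A i → ℝ :=
  fun c => Real.exp (utilityAction u i c b.prof / σ) /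
    ∑ c' : A i, Real.exp (utilityAction u i c' b.prof / σ)

/-- `π` is an `ε`-Nash equilibrium in mixed strategies. -/
def IsEpsNash (u : I → (∀ j, A j) → ℝ) (ε : ℝ) (π : ∀ j, A j → ℝ) : Prop :=
  (∀ i, π i ∈ stdSimplex ℝ (A i)) ∧
    ∀ i, ∀ p ∈ stdSimplex ℝ (A i), utility u i (Function.update π i p) - ε ≤ utility u i π

/-! ### Euclidean distances -/

/-- Euclidean distance of two (mixed) strategies of one player. -/
def stratDist {α : Type*} [Fintype α] (p q : α → ℝ) : ℝ :=
  Real.sqrt (∑ c, (p c - q c) ^ 2)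

/-- Euclidean distance `‖p - q‖₂` of two strategy profiles `(p_j)_{j ≠ i}`, `(q_j)_{j ≠ i}` of the
opponents of player `i`. -/
def profDist {i : I} (p q : ∀ j : {j : I // j ≠ i}, A j → ℝ) : ℝ :=
  Real.sqrt (∑ j, ∑ c, (p j c - q j c) ^ 2)

/-! ### States -/

/-- A state `(b, π)`: a belief of every player together with the smooth best responses. -/
@[ext]
structure State (u : I → (∀ j, A j) → ℝ) (σ : ℝ) (M : ℕ) where
  belief : ∀ i, Belief A M i
  strategy : ∀ i, A i → ℝ
  strategy_eq : ∀ i, strategy i = smoothBR u σ i (belief i)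

/-- A state is determined by its beliefs. -/
def stateEquiv (u : I → (∀ j, A j) → ℝ) (σ : ℝ) (M : ℕ) :
    (∀ i, Belief A M i) ≃ State u σ M where
  toFun b := ⟨b, fun i => smoothBR u σ i (b i), fun _ => rfl⟩
  invFun z := z.belief
  left_inv _ := rfl
  right_inv z := State.ext rfl (funext fun i => (z.strategy_eq i).symm)

instance (u : I → (∀ j, A j) → ℝ) (σ : ℝ) (M : ℕ) : Fintype (State u σ M) :=
  Fintype.ofEquiv _ (stateEquiv u σ M)

variable {u : I → (∀ j, A j) → ℝ} {σ : ℝ} {M : ℕ}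

/-- `π_{-i}`: the strategies that the opponents of player `i` play in the state `z`. -/
def State.opp (z : State u σ M) (i : I) : ∀ j : {j : I // j ≠ i}, A j → ℝ :=
  fun j => z.strategy j

/-- The state is consistent: every belief is within distance `τ` of the opponents' strategies. -/
def State.Consistent (τ : ℝ) (z : State u σ M) : Prop :=
  ∀ i, profDist (z.belief i).prof (z.opp i) ≤ τ

/-- The transformed utility `f_i(U_i(π_i, b_i))` of player `i` in the state `z`. -/
def State.transformed (f : I → ℝ → ℝ) (z : State u σ M) (i : I) : ℝ :=
  f i (utilityAgainst u i (z.strategy i) (z.belief i).prof)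

/-- The minimum over the players of the transformed utility in the state `z`. -/
def State.minTransformed [Nonempty I] (f : I → ℝ → ℝ) (z : State u σ M) : ℝ :=
  Finset.univ.inf' Finset.univ_nonempty (z.transformed f)

/-! ### The hypothesis test -/

/-- The number `|A_{-i}|` of joint actions of the opponents of player `i`. -/
def oppCard (A : I → Type*) [∀ i, Fintype (A i)] (i : I) : ℕ :=
  Fintype.card (∀ j : {j : I // j ≠ i}, A j)

/-- The empirical estimate of the opponents' strategy profile from `T` joint observations: the
observed frequency of each action `c` of each opponent `j`. -/
def empirical {T : ℕ} {i : I} (a : Fin T → ∀ j : {j : I // j ≠ i}, A j) :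
    ∀ j : {j : I // j ≠ i}, A j → ℝ :=
  fun j c => (1 / (T : ℝ)) * ∑ t, if a t j = c then 1 else 0

/-- The test of player `i` with significance level `α` rejects the belief `b` on the sample `a`. -/
def Rejects (τ α : ℝ) {T : ℕ} {i : I} (b : Belief A M i)
    (a : Fin T → ∀ j : {j : I // j ≠ i}, A j) : Prop :=
  τ + Real.sqrt ((oppCard A i : ℝ) / (2 * (T : ℝ)) * Real.log (2 / α)) <
    profDist (empirical a) b.prof

/-- The sample size `T` is sufficient at significance level `α`: it is at least
`2 |A_{-i}| / (‖π_{-i} - b_i‖ - τ)² · ln (2 / α)` for every player `i`, every belief `b_i` and every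
profile `π_{-i}` of smooth best responses with `‖π_{-i} - b_i‖ > τ`. -/
def SufficientSample (u : I → (∀ j, A j) → ℝ) (σ τ : ℝ) (M : ℕ) (α : ℝ) (T : ℕ) : Prop :=
  ∀ (i : I) (b : Belief A M i) (b' : ∀ j : {j : I // j ≠ i}, Belief A M j.1),
    τ < profDist (fun j => smoothBR u σ j.1 (b' j)) b.prof →
      2 * (oppCard A i : ℝ) / (profDist (fun j => smoothBR u σ j.1 (b' j)) b.prof - τ) ^ 2 *
        Real.log (2 / α) ≤ (T : ℝ)

/-! ### The learning dynamics -/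

open scoped Classical in
/-- Probability that a player moves from belief `b` to `b'` in one epoch, given whether the test
(if it is conducted) rejects. The test is conducted with probability `g`; after a rejection the
belief is resampled from `ψ b`; otherwise it is resampled with probability `e` and kept with
probability `1 - e`. Without a test the belief is kept. -/
def updateProb {β : Type*} (g e : ℝ) (ψ : β → β → ℝ) (reject : Prop) (b b' : β) : ℝ :=
  (1 - g) * (if b' = b then 1 else 0) +
    g * (if reject then ψ b b' else e * ψ b b' + (1 - e) * (if b' = b then 1 else 0))

/-- The transition probability `P^ξ_{zz'}` of one epoch: `T(ξ^ū)` joint actions are drawn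
independently from `π`; given them, the players update independently. Here `ψ i b b'` is the
probability that player `i` with current belief `b` resamples `b'`. -/
def transition (u : I → (∀ j, A j) → ℝ) (σ τ : ℝ) (M : ℕ) (γ : I → ℝ) (f : I → ℝ → ℝ)
    (ubar : ℝ) (T : ℝ → ℕ) (ψ : ∀ i, Belief A M i → Belief A M i → ℝ) (ξ : ℝ)
    (z z' : State u σ M) : ℝ :=
  ∑ a : Fin (T (ξ ^ ubar)) → ∀ i, A i,
    (∏ t, ∏ i, z.strategy i (a t i)) *
      ∏ i, updateProb (γ i) (ξ ^ z.transformed f i) (ψ i)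
        (Rejects τ (ξ ^ ubar) (z.belief i) (fun t (j : {j : I // j ≠ i}) => a t j.1))
        (z.belief i) (z'.belief i)

/-! ### Stochastic stability -/

/-- `μ` is a stationary probability distribution of the transition matrix `P`. -/
def IsStationary {S : Type*} [Fintype S] (P : S → S → ℝ) (μ : S → ℝ) : Prop :=
  (∀ z, 0 ≤ μ z) ∧ ∑ z, μ z = 1 ∧ ∀ z', ∑ z, μ z * P z z' = μ z'

/-- `μ` assigns to every `ξ ∈ (0, 1)` a stationary distribution of `P ξ`. -/
def IsStationaryFamily {S : Type*} [Fintype S] (P : ℝ → S → S → ℝ) (μ : ℝ → S → ℝ) : Prop :=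
  ∀ ξ ∈ Set.Ioo (0 : ℝ) 1, IsStationary (P ξ) (μ ξ)

/-- The state `z` is stochastically stable: `lim_{ξ → 0} μ^ξ_z` exists and is positive. -/
def StochasticallyStable {S : Type*} [Fintype S] (P : ℝ → S → S → ℝ) (z : S) : Prop :=
  ∃ μ : ℝ → S → ℝ, IsStationaryFamily P μ ∧
    ∃ l : ℝ, 0 < l ∧ Tendsto (fun ξ => μ ξ z) (𝓝[>] 0) (𝓝 l)

/-! ### The assumptions -/

/-- `max_i |A_i|`. -/
def maxActions (A : I → Type*) [∀ i, Fintype (A i)] : ℕ :=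
  Finset.univ.sup fun i => Fintype.card (A i)

/-- `max_i |A_i| |A_{-i}|`. -/
def maxProfiles (A : I → Type*) [∀ i, Fintype (A i)] : ℕ :=
  Finset.univ.sup fun i => Fintype.card (A i) * oppCard A i

/-- `max_{i, a} |u_i(a)|`. -/
def maxPayoff [Nonempty I] [∀ i, Nonempty (A i)] (u : I → (∀ j, A j) → ℝ) : ℝ :=
  Finset.univ.sup' Finset.univ_nonempty fun i =>
    Finset.univ.sup' Finset.univ_nonempty fun a => |u i a|

/-- The conditions on `σ`, `τ`, `M` for the precision `ε`; the upper bounds on `σ` and `τ` are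
written without quotients, so that they are void when their denominators vanish. -/
structure ParameterConditions [Nonempty I] [∀ i, Nonempty (A i)] (u : I → (∀ j, A j) → ℝ)
    (ε σ τ : ℝ) (M : ℕ) : Prop where
  sigma_le : σ * (2 * Real.log (maxActions A : ℝ)) ≤ ε
  tau_le : τ * (2 * Real.sqrt (Fintype.card (∀ i, A i) : ℝ) *
    (maxPayoff u * (maxProfiles A : ℝ))) ≤ ε * σ
  le_M : (Fintype.card I : ℝ) * (maxActions A : ℝ) / τ *
    (1 + Real.sqrt (maxActions A : ℝ) / σ * maxPayoff u * (maxProfiles A : ℝ) *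
      (Fintype.card I : ℝ)) ≤ (M : ℝ)

/-- Every player has, against all beliefs and smooth best responses of the opponents, a bad
belief: it is inconsistent with the opponents' strategies, and the smooth best response to it is
inconsistent with what each opponent believes about the player. -/
def BadBeliefs (u : I → (∀ j, A j) → ℝ) (σ τ : ℝ) (M : ℕ) : Prop :=
  ∀ (i : I) (b : ∀ j : {j : I // j ≠ i}, Belief A M j.1),
    ∃ b' : Belief A M i,
      τ < profDist b'.prof (fun j => smoothBR u σ j.1 (b j)) ∧
      ∀ j : {j : I // j ≠ i},
        τ < stratDist (smoothBR u σ i b') (b j ⟨i, j.2.symm⟩ : A i → ℝ)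

end HypothesisLearning

end

open Set Filter Topology

noncomputable section

namespace HypothesisLearning

section

/-! ### A fixed point theorem for continuously differentiable maps -/

section FixedPoint

open MeasureTheory

variable {E : Type*} [NormedAddCommGroup E] [InnerProductSpace ℝ E] [FiniteDimensional ℝ E]

/-! A state `z` is left with probability of order `ξ ^ ρ z`. In a consistent state a test rejects
only by error, so a departure needs a resampling after an accepting test; the cheapest one has
probability of order `ξ ^ min_i f_i`, and this minimum is `ρ z`. In an inconsistent state some test
rejects with probability near one, and `ρ z = 0`. Test errors have probability `O(ξ ^ ubar)` by
Hoeffding's inequality and a union bound; they are negligible because `ubar` exceeds every `f_i`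
that occurs (`abs_transition_sub_le`, `tendsto_rpow_mul_transition`).

Multiply row `z` of `P - 1` by `ξ ^ (-ρ z)`. The rescaled generators converge to a rate matrix `R`.
By the bad beliefs `R` is irreducible: one dominant move makes every player's belief inconsistent,
and from there a second one reaches any state (`reflTransGen_dominantMove`). If `μ` is stationary,
then `ξ ^ ρ z * μ z` is invariant for the rescaled generator, so after normalization it converges to
the unique, strictly positive invariant vector `w` of `R`. Thus `μ z` is asymptotically proportional
to `ξ ^ (-ρ z) * w z` and concentrates on the maximizers of `ρ` (`exists_tendsto_stationary`); no
counting of trees is needed.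

As the `f_i` are positive, these maximizers are the consistent max-min states as soon as a
consistent state exists. One is found by rounding a logit equilibrium to the grid
(`exists_consistent`). The equilibrium comes from Brouwer's theorem for continuously differentiable
maps, proved through the Milnor–Rogers volume argument against retractions
(`not_contDiff_retraction`).

In a consistent state a deviation gains at most the entropy loss `σ log m` of the logit response
plus twice the payoff error caused by the belief, which gives the approximate equilibrium. -/

theorem exists_polynomial_det_one_add_smul (L : E →L[ℝ] E) :
    ∃ p : Polynomial ℝ, p.natDegree ≤ Module.finrank ℝ E ∧
      ∀ t : ℝ, p.eval t = ((1 : E →L[ℝ] E) + t • L).det := by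
  classical
  let b := Module.finBasis ℝ E
  let B := LinearMap.toMatrix b b (L : E →ₗ[ℝ] E)
  refine ⟨((Polynomial.X : Polynomial ℝ) • B.map Polynomial.C +
    (1 : Matrix (Fin (Module.finrank ℝ E)) (Fin (Module.finrank ℝ E)) ℝ).map Polynomial.C).det,
    ?_, fun t => ?_⟩
  · simpa using Polynomial.natDegree_det_X_add_C_le B 1
  · have h1 : ((1 : E →L[ℝ] E) + t • L).det
        = (LinearMap.toMatrix b b ((1 : E →ₗ[ℝ] E) + t • (L : E →ₗ[ℝ] E))).det := by
      rw [LinearMap.det_toMatrix]; rfl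
    rw [h1, ← Polynomial.coe_evalRingHom, RingHom.map_det]
    congr 1
    rw [map_add (LinearMap.toMatrix b b), map_smul (LinearMap.toMatrix b b),
      LinearMap.toMatrix_one]
    ext i j
    by_cases h : i = j <;>
      simp [Matrix.map_apply, B, h] <;> ring

/-- The integral of `det (1 + t A(x))` over a bounded set is a polynomial in `t`. -/
theorem exists_polynomial_integral_det [MeasurableSpace E] [BorelSpace E] (μ : Measure E)
    [IsFiniteMeasureOnCompacts μ]
    {L : E → E →L[ℝ] E} (hL : Continuous L) (R : ℝ) :
    ∃ p : Polynomial ℝ, ∀ t : ℝ,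
      p.eval t = ∫ x in Metric.ball (0 : E) R, ((1 : E →L[ℝ] E) + t • L x).det ∂μ := by
  classical
  set n := Module.finrank ℝ E
  have hint : ∀ t : ℝ, IntegrableOn (fun x => ((1 : E →L[ℝ] E) + t • L x).det)
      (Metric.ball (0 : E) R) μ := fun t => by
    have hc : Continuous fun x => ((1 : E →L[ℝ] E) + t • L x).det :=
      ContinuousLinearMap.continuous_det.comp (by fun_prop)
    exact (hc.continuousOn.integrableOn_compact (isCompact_closedBall (0 : E) R)).mono_set
      Metric.ball_subset_closedBall
  -- A polynomial of degree at most `n` is a fixed linear combination of its values at `0, …, n`.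
  -- Integrating this identity in `x` avoids any discussion of how the coefficients depend on `x`.
  let v : ℕ → ℝ := fun k => k
  have hv : Set.InjOn v (Finset.range (n + 1) : Set ℕ) := fun a _ b _ h => Nat.cast_injective h
  refine ⟨Lagrange.interpolate (Finset.range (n + 1)) v fun k =>
    ∫ x in Metric.ball (0 : E) R, ((1 : E →L[ℝ] E) + (k : ℝ) • L x).det ∂μ, fun t => ?_⟩
  have hx : ∀ x, ((1 : E →L[ℝ] E) + t • L x).det = ∑ k ∈ Finset.range (n + 1),
      ((1 : E →L[ℝ] E) + (k : ℝ) • L x).det *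
        (Lagrange.basis (Finset.range (n + 1)) v k).eval t := fun x => by
    obtain ⟨p, hp, hpe⟩ := exists_polynomial_det_one_add_smul (L x)
    have hd : p.degree < (Finset.range (n + 1)).card := by
      rw [Finset.card_range]
      exact (Polynomial.degree_le_natDegree).trans_lt (by exact_mod_cast Nat.lt_succ_of_le hp)
    have := Lagrange.eq_interpolate hv hd
    rw [← hpe, this]
    simp [Lagrange.interpolate_apply, Polynomial.eval_finsetSum, v, hpe]
  simp_rw [hx]
  refine Eq.trans ?_ (integral_finsetSum (Finset.range (n + 1))
    fun k _ => (hint (k : ℝ)).mul_const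
      ((Lagrange.basis (Finset.range (n + 1)) v k).eval t)).symm
  simp [Lagrange.interpolate_apply, Polynomial.eval_finsetSum, integral_mul_const]

/-- A segment from a point of the ball to a point outside crosses the sphere, where `g` vanishes, so
the Lipschitz bound inside the ball already controls the jump. -/
theorem lipschitzWith_indicator_closedBall {E : Type*} [NormedAddCommGroup E] [NormedSpace ℝ E]
    {g : E → E} {R : ℝ} {K : NNReal}
    (hg : LipschitzOnWith K g (Metric.closedBall 0 R)) (h0 : ∀ x, ‖x‖ = R → g x = 0) :
    LipschitzWith K ((Metric.closedBall (0 : E) R).indicator g) := by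
  have key : ∀ x ∈ Metric.closedBall (0 : E) R, ∀ y ∉ Metric.closedBall (0 : E) R,
      dist (g x) 0 ≤ K * dist x y := by
    intro x hx y hy
    simp only [mem_closedBall_zero_iff, not_le] at hx hy
    obtain ⟨t, ht, htR⟩ := intermediate_value_Icc zero_le_one
      (f := fun t : ℝ => ‖x + t • (y - x)‖) (by fun_prop) (show R ∈ _ by simp [hx, hy.le])
    have hw : dist x (x + t • (y - x)) ≤ dist x y := by
      rw [dist_eq_norm, dist_eq_norm, norm_sub_rev x y]
      simp only [sub_add_cancel_left, norm_neg, norm_smul, Real.norm_eq_abs, abs_of_nonneg ht.1]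
      exact mul_le_of_le_one_left (norm_nonneg _) ht.2
    rw [← h0 _ htR]
    refine (hg.dist_le_mul x (by simpa using hx) _ (by simpa using htR.le)).trans ?_
    gcongr
  refine LipschitzWith.of_dist_le_mul fun x y => ?_
  by_cases hx : x ∈ Metric.closedBall (0 : E) R <;> by_cases hy : y ∈ Metric.closedBall (0 : E) R
  · simpa [Set.indicator_of_mem hx, Set.indicator_of_mem hy] using hg.dist_le_mul x hx y hy
  · rw [Set.indicator_of_mem hx, Set.indicator_of_notMem hy]
    exact key x hx y hy
  · rw [Set.indicator_of_notMem hx, Set.indicator_of_mem hy, dist_comm, dist_comm x]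
    exact key y hy x hx
  · rw [Set.indicator_of_notMem hx, Set.indicator_of_notMem hy, dist_self]
    positivity

/-- The map differs from the identity by a map with Lipschitz constant below one, so the
quantitative inverse function theorem applies on the whole space. -/
theorem bijective_id_add_smul {g : E → E} {K : NNReal} (hg : LipschitzWith K g) {t : ℝ}
    (ht : |t| * K < 1) : Function.Bijective fun x => x + t • g x := by
  have ha : ApproximatesLinearOn (fun x => x + t • g x)
      ((ContinuousLinearEquiv.refl ℝ E : E ≃L[ℝ] E) : E →L[ℝ] E) Set.univ (‖t‖₊ * K) := by
    intro x _ y _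
    have : x + t • g x - (y + t • g y) -
        ((ContinuousLinearEquiv.refl ℝ E : E ≃L[ℝ] E) : E →L[ℝ] E) (x - y)
        = t • (g x - g y) := by
      simp [smul_sub]; abel
    rw [this, norm_smul]
    have := hg.norm_sub_le x y
    push_cast
    rw [mul_assoc]
    gcongr
  have hc : Subsingleton E ∨ ‖t‖₊ * K <
      ‖(((ContinuousLinearEquiv.refl ℝ E : E ≃L[ℝ] E).symm : E →L[ℝ] E))‖₊⁻¹ := by
    rcases subsingleton_or_nontrivial E with h | h
    · exact Or.inl h
    · right
      have : ‖(((ContinuousLinearEquiv.refl ℝ E : E ≃L[ℝ] E).symm : E →L[ℝ] E))‖₊ = 1 := by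
        ext
        simp
      rw [this, inv_one, ← NNReal.coe_lt_coe]
      simpa using ht
  exact ⟨(ha.injective hc : Function.Injective _).comp (f := fun x => (⟨x, trivial⟩ : univ))
    (fun a b h => congrArg Subtype.val h), ha.surjective hc⟩

/-- There is no continuously differentiable retraction onto a sphere. -/
theorem not_contDiff_retraction {R : ℝ} (hR : 0 < R) {r : E → E} (hr : ContDiff ℝ 1 r)
    (hn : ∀ x, ‖r x‖ = R) (hid : ∀ x, ‖x‖ = R → r x = x) : False := by
  borelize E
  let μ : Measure E := volume
  set g₀ : E → E := fun x => r x - x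
  have hg₀ : ContDiff ℝ 1 g₀ := hr.sub contDiff_id
  obtain ⟨K, hK⟩ := (hg₀.contDiffOn (s := Metric.closedBall 0 R)).exists_lipschitzOnWith
    one_ne_zero (convex_closedBall _ _) (isCompact_closedBall _ _)
  -- After the cut-off, `x + t • g x` is the identity outside the ball. For small `t` it is a
  -- bijection of `E`, hence it maps the ball onto itself.
  set g := (Metric.closedBall (0 : E) R).indicator g₀
  have hg : LipschitzWith K g := lipschitzWith_indicator_closedBall hK fun x hx => by
    simp [g₀, hid x hx]
  have hg_out : ∀ x, R ≤ ‖x‖ → g x = 0 := fun x hx => by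
    by_cases h : x ∈ Metric.closedBall (0 : E) R
    · have h' : ‖x‖ = R := le_antisymm (by simpa using h) hx
      simp [g, Set.indicator_of_mem h, g₀, hid x h']
    · simp [g, Set.indicator_of_notMem h]
  have hD : Continuous (fderiv ℝ g₀) := hg₀.continuous_fderiv one_ne_zero
  obtain ⟨p, hp⟩ := exists_polynomial_integral_det μ hD R
  -- The determinant is `1` at `t = 0`; compactness makes it positive on the whole ball for small
  -- `t`, which removes the absolute value in the change of variables.
  have hpos : ∀ᶠ t : ℝ in 𝓝 0, ∀ x ∈ Metric.closedBall (0 : E) R,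
      0 < ((1 : E →L[ℝ] E) + t • fderiv ℝ g₀ x).det := by
    refine (isCompact_closedBall (0 : E) R).eventually_forall_of_forall_eventually fun x _ => ?_
    have hc : Continuous fun z : ℝ × E => ((1 : E →L[ℝ] E) + z.1 • fderiv ℝ g₀ z.2).det :=
      ContinuousLinearMap.continuous_det.comp (by fun_prop)
    refine hc.continuousAt.eventually (lt_mem_nhds ?_)
    have : ((1 : E →L[ℝ] E)).det = 1 := LinearMap.det_id
    simp [this]
  have hsmall : ∀ᶠ t : ℝ in 𝓝 0, |t| * K < 1 :=
    (show Continuous fun t : ℝ => |t| * (K : ℝ) by fun_prop).continuousAt.eventually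
      (gt_mem_nhds (by simp))
  have hconst : ∀ᶠ t : ℝ in 𝓝 0, p.eval t = μ.real (Metric.ball (0 : E) R) := by
    filter_upwards [hpos, hsmall] with t htp hts
    have hbij := bijective_id_add_smul hg hts
    have himg : (fun x => x + t • g x) '' Metric.ball (0 : E) R = Metric.ball (0 : E) R := by
      apply Subset.antisymm
      · rintro _ ⟨x, hx, rfl⟩
        by_contra hy
        have hy' : R ≤ ‖x + t • g x‖ := by simpa using hy
        have h1 : (fun x => x + t • g x) (x + t • g x) = (fun x => x + t • g x) x := by
          simp [hg_out _ hy']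
        exact hy (show x + t • g x ∈ _ from (show x + t • g x = x from hbij.1 h1).symm ▸ hx)
      · intro y hy
        obtain ⟨x, hx⟩ := hbij.2 y
        refine ⟨x, ?_, hx⟩
        by_contra hxR
        have hx' : R ≤ ‖x‖ := by simpa using hxR
        have hxy : x = y := by simpa [hg_out x hx'] using hx
        exact hxR (hxy ▸ hy)
    have hder : ∀ x ∈ Metric.ball (0 : E) R, HasFDerivWithinAt (fun x => x + t • g x)
        ((1 : E →L[ℝ] E) + t • fderiv ℝ g₀ x) (Metric.ball (0 : E) R) x := fun x hx => by
      have h1 : HasFDerivAt (fun x => x + t • g₀ x) ((1 : E →L[ℝ] E) + t • fderiv ℝ g₀ x) x :=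
        (hasFDerivAt_id x).add
          (((hg₀.differentiable one_ne_zero).differentiableAt.hasFDerivAt).const_smul t)
      refine h1.hasFDerivWithinAt.congr (fun y hy => ?_) ?_
      · simp [g, Set.indicator_of_mem (Metric.ball_subset_closedBall hy)]
      · simp [g, Set.indicator_of_mem (Metric.ball_subset_closedBall hx)]
    have hvol := lintegral_abs_det_fderiv_eq_addHaar_image μ measurableSet_ball hder
      hbij.1.injOn
    rw [himg] at hvol
    rw [hp, integral_eq_lintegral_of_nonneg_ae, Measure.real, ← hvol]
    · congr 1
      refine setLIntegral_congr_fun measurableSet_ball fun x hx => ?_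
      rw [abs_of_pos (htp x (Metric.ball_subset_closedBall hx))]
    · refine (ae_restrict_iff' measurableSet_ball).2 (Eventually.of_forall fun x hx => ?_)
      exact (htp x (Metric.ball_subset_closedBall hx)).le
    · have hc : Continuous fun x => ((1 : E →L[ℝ] E) + t • fderiv ℝ g₀ x).det :=
        ContinuousLinearMap.continuous_det.comp (by fun_prop)
      exact hc.aestronglyMeasurable
  -- A polynomial that is constant near `0` is constant. The value at `t = 1`, where the map is `r`,
  -- must therefore also be the volume of the ball.
  have hpc : p = Polynomial.C (μ.real (Metric.ball (0 : E) R)) := by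
    refine Polynomial.eq_of_infinite_eval_eq _ _ ?_
    simp only [Polynomial.eval_C]
    exact infinite_of_mem_nhds (0 : ℝ) hconst
  -- Since `‖r‖` is constant, `r x` is orthogonal to the range of the derivative at `x`. An
  -- invertible derivative would have `r x ≠ 0` in its range.
  have hdet : ∀ x, ((1 : E →L[ℝ] E) + (1 : ℝ) • fderiv ℝ g₀ x).det = 0 := fun x => by
    have hrd : HasFDerivAt r (fderiv ℝ r x) x :=
      (hr.differentiable one_ne_zero).differentiableAt.hasFDerivAt
    have h1 : (1 : E →L[ℝ] E) + (1 : ℝ) • fderiv ℝ g₀ x = fderiv ℝ r x := by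
      have : HasFDerivAt g₀ (fderiv ℝ r x - 1) x := hrd.sub (hasFDerivAt_id x)
      rw [this.fderiv]; simp
    rw [h1]
    by_contra hne
    have hsq := hrd.norm_sq
    have hsq' : HasFDerivAt (fun y => ‖r y‖ ^ 2) (0 : E →L[ℝ] ℝ) x := by
      simp_rw [hn]; exact hasFDerivAt_const _ _
    obtain ⟨v, hv⟩ := (LinearMap.equivOfDetNeZero _ hne).surjective (r x)
    have hv' : fderiv ℝ r x v = r x := hv
    have := congrArg (fun l : E →L[ℝ] ℝ => l v) (hsq.unique hsq')
    simp [hv', hn] at this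
    exact hR.ne' this
  have h1 := hp 1
  simp only [hdet, hpc, Polynomial.eval_C, integral_zero] at h1
  have h2 : 0 < μ.real (Metric.ball (0 : E) R) :=
    ENNReal.toReal_pos (Metric.measure_ball_pos μ _ hR).ne' measure_ball_lt_top.ne
  exact h2.ne' h1

/-- A continuously differentiable self-map with bounded range has a fixed point. -/
theorem exists_fixedPoint_of_contDiff {R : ℝ} {F : E → E} (hF : ContDiff ℝ 1 F)
    (hb : ∀ x, ‖F x‖ < R) : ∃ x, F x = x := by
  by_contra! hne
  have hR : 0 < R := (norm_nonneg _).trans_lt (hb 0)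
  set v : E → E := fun x => x - F x
  have hv : ContDiff ℝ 1 v := contDiff_id.sub hF
  have hv0 : ∀ x, 0 < ‖v x‖ ^ 2 := fun x => by
    have : v x ≠ 0 := sub_ne_zero.2 (hne x).symm
    positivity
  set b : E → ℝ := fun x => inner ℝ (F x) (v x)
  set c : E → ℝ := fun x => R ^ 2 - ‖F x‖ ^ 2
  have hc0 : ∀ x, 0 < c x := fun x => by
    have := hb x
    have := norm_nonneg (F x)
    simp only [c]; nlinarith
  have hdisc : ∀ x, 0 < b x ^ 2 + ‖v x‖ ^ 2 * c x := fun x => by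
    have := mul_pos (hv0 x) (hc0 x); positivity
  -- The larger root of the quadratic `‖F x + s v x‖² = R²`: the ray from `F x` through `x` meets
  -- the sphere there. As `‖F x‖ < R` and `v x ≠ 0`, the discriminant is positive and the root
  -- depends smoothly on `x`.
  set s : E → ℝ := fun x => (-b x + Real.sqrt (b x ^ 2 + ‖v x‖ ^ 2 * c x)) / ‖v x‖ ^ 2
  have hbC : ContDiff ℝ 1 b := hF.inner ℝ hv
  have hvC : ContDiff ℝ 1 fun x => ‖v x‖ ^ 2 := hv.norm_sq ℝ
  have hcC : ContDiff ℝ 1 c := contDiff_const.sub (hF.norm_sq ℝ)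
  have hs : ContDiff ℝ 1 s := by
    refine (hbC.neg.add (((hbC.pow 2).add (hvC.mul hcC)).sqrt fun x => (hdisc x).ne')).div hvC
      fun x => (hv0 x).ne'
  refine not_contDiff_retraction hR (r := fun x => F x + s x • v x) (hF.add (hs.smul hv))
    (fun x => ?_) (fun x hx => ?_)
  · have hq : ‖F x + s x • v x‖ ^ 2 = R ^ 2 := by
      rw [norm_add_sq_real, inner_smul_right, norm_smul, mul_pow, Real.norm_eq_abs, sq_abs]
      have h1 : s x * ‖v x‖ ^ 2 + b x = Real.sqrt (b x ^ 2 + ‖v x‖ ^ 2 * c x) := by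
        have := (hv0 x).ne'
        simp only [s]; rw [div_mul_cancel₀ _ this]; ring
      have h2 : (s x * ‖v x‖ ^ 2 + b x) ^ 2 = b x ^ 2 + ‖v x‖ ^ 2 * c x := by
        rw [h1, Real.sq_sqrt (hdisc x).le]
      have h3 : ‖v x‖ ^ 2 * (s x ^ 2 * ‖v x‖ ^ 2 + 2 * s x * b x - c x) = 0 := by
        linear_combination h2
      have h4 := (mul_eq_zero.1 h3).resolve_left (hv0 x).ne'
      simp only [c] at h4
      change ‖F x‖ ^ 2 + 2 * (s x * b x) + s x ^ 2 * ‖v x‖ ^ 2 = R ^ 2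
      linear_combination h4
    exact (sq_eq_sq₀ (norm_nonneg _) hR.le).1 hq
  -- On the sphere `s = 1` is a root. It is the larger one because `‖v‖² + b = (‖v‖² + c) / 2` is
  -- positive.
  · have hx1 : ‖v x‖ ^ 2 + 2 * b x = c x := by
      have : ‖F x + v x‖ ^ 2 = R ^ 2 := by simp [v, hx]
      rw [norm_add_sq_real] at this
      simp only [c, b]; linarith
    have h1 : Real.sqrt (b x ^ 2 + ‖v x‖ ^ 2 * c x) = ‖v x‖ ^ 2 + b x := by
      have : b x ^ 2 + ‖v x‖ ^ 2 * c x = (‖v x‖ ^ 2 + b x) ^ 2 := by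
        rw [← hx1]; ring
      rw [this, Real.sqrt_sq]
      linarith [hv0 x, hc0 x]
    have h2 : s x = 1 := by
      have := (hv0 x).ne'
      simp only [s, h1]; rw [div_eq_one_iff_eq this]; ring
    simp [h2, v]

end FixedPoint

end

section

/-! ### Invariant vectors of rate matrices -/

section RateMatrix

variable {S : Type*} [Fintype S]

/-- A rate matrix: non-negative off the diagonal, with vanishing row sums. -/
structure IsRateMatrix (R : S → S → ℝ) : Prop where
  offDiag_nonneg : ∀ z z', z ≠ z' → 0 ≤ R z z'
  row_sum : ∀ z, ∑ z', R z z' = 0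

/-- `v` is a left null vector of `R`. -/
def IsInvariant (R : S → S → ℝ) (v : S → ℝ) : Prop :=
  ∀ z', ∑ z, v z * R z z' = 0

/-- Every state can be reached from every other one through positive rates. -/
def IsIrreducible (R : S → S → ℝ) : Prop :=
  ∀ z z', Relation.ReflTransGen (fun x y => 0 < R x y) z z'

variable {R : S → S → ℝ}

theorem IsInvariant.neg {v : S → ℝ} (hv : IsInvariant R v) : IsInvariant R (-v) := fun z' => by
  simp [Finset.sum_neg_distrib, hv z']

theorem IsInvariant.sub {v w : S → ℝ} (hv : IsInvariant R v) (hw : IsInvariant R w) :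
    IsInvariant R (v - w) := fun z' => by
  simp [sub_mul, Finset.sum_sub_distrib, hv z', hw z']

theorem IsInvariant.smul {v : S → ℝ} (hv : IsInvariant R v) (c : ℝ) :
    IsInvariant R (c • v) := fun z' => by
  simp [mul_assoc, ← Finset.mul_sum, hv z']

/-- Passing to the positive part leaves the diagonal term of a column unchanged or makes it vanish
and only increases the other terms, so every column sum is non-negative. Their total is zero by the
vanishing row sums, hence each is zero. -/
theorem IsRateMatrix.isInvariant_max_zero (hR : IsRateMatrix R) {v : S → ℝ}
    (hv : IsInvariant R v) : IsInvariant R fun z => max (v z) 0 := by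
  have hge : ∀ z', 0 ≤ ∑ z, max (v z) 0 * R z z' := fun z' => by
    rcases lt_or_ge 0 (v z') with h | h
    · refine (hv z').symm.le.trans (Finset.sum_le_sum fun z _ => ?_)
      by_cases hz : z = z'
      · rw [hz, max_eq_left h.le]
      · exact mul_le_mul_of_nonneg_right (le_max_left _ _) (hR.offDiag_nonneg _ _ hz)
    · refine Finset.sum_nonneg fun z _ => ?_
      by_cases hz : z = z'
      · rw [hz, max_eq_right h, zero_mul]
      · exact mul_nonneg (le_max_right _ _) (hR.offDiag_nonneg _ _ hz)
  have hsum : ∑ z', ∑ z, max (v z) 0 * R z z' = 0 := by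
    rw [Finset.sum_comm]
    simp [← Finset.mul_sum, hR.row_sum]
  exact fun z' => (Finset.sum_eq_zero_iff_of_nonneg fun z _ => hge z).1 hsum z' (Finset.mem_univ _)

/-- Vanishing row sums make the matrix singular, so there is a non-zero left null vector. The
positive part of it or of its negative is non-zero and can be normalized. -/
theorem IsRateMatrix.exists_isInvariant [Nonempty S] (hR : IsRateMatrix R) :
    ∃ v ∈ stdSimplex ℝ S, IsInvariant R v := by
  classical
  have hdet : (Matrix.of R).det = 0 := by
    refine Matrix.exists_mulVec_eq_zero_iff.1 ⟨fun _ => 1, ?_, ?_⟩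
    · obtain ⟨z⟩ := ‹Nonempty S›
      exact fun h => one_ne_zero (congrFun h z)
    · ext z
      simpa [Matrix.mulVec, dotProduct] using hR.row_sum z
  obtain ⟨v, hv0, hv⟩ := Matrix.exists_vecMul_eq_zero_iff.2 hdet
  have hv' : IsInvariant R v := fun z' => by
    simpa [Matrix.vecMul, dotProduct] using congrFun hv z'
  have key : ∀ w : S → ℝ, IsInvariant R w → (∃ z, 0 < w z) →
      ∃ v ∈ stdSimplex ℝ S, IsInvariant R v := by
    rintro w hw ⟨z, hz⟩
    have hpos : 0 < ∑ z, max (w z) 0 :=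
      Finset.sum_pos' (fun _ _ => le_max_right _ _) ⟨z, Finset.mem_univ _, lt_max_of_lt_left hz⟩
    refine ⟨(∑ z, max (w z) 0)⁻¹ • fun z => max (w z) 0, ⟨fun z => ?_, ?_⟩,
      (hR.isInvariant_max_zero hw).smul _⟩
    · exact mul_nonneg (inv_nonneg.2 hpos.le) (le_max_right _ _)
    · simp only [Pi.smul_apply, smul_eq_mul, ← Finset.mul_sum]
      exact inv_mul_cancel₀ hpos.ne'
  obtain ⟨z, hz⟩ := Function.ne_iff.1 hv0
  rcases lt_or_gt_of_ne hz with h | h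
  · exact key (-v) hv'.neg ⟨z, by simpa using h⟩
  · exact key v hv' ⟨z, h⟩

/-- At a zero of `w` the invariance equation is a vanishing sum of non-negative terms, so no mass
can flow in. Positivity thus spreads along positive rates. -/
theorem IsRateMatrix.pos_of_isInvariant (hR : IsRateMatrix R) (hirr : IsIrreducible R)
    {w : S → ℝ} (hw : IsInvariant R w) (h0 : ∀ z, 0 ≤ w z) {z₀ : S} (hz₀ : 0 < w z₀) (z : S) :
    0 < w z := by
  have step : ∀ x y, 0 < R x y → 0 < w x → 0 < w y := by
    intro x y hxy hx
    refine (h0 y).lt_of_ne fun hy => ?_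
    have hterm : ∀ z ∈ Finset.univ, 0 ≤ w z * R z y := fun z _ => by
      by_cases hz : z = y
      · rw [hz, ← hy, zero_mul]
      · exact mul_nonneg (h0 z) (hR.offDiag_nonneg _ _ hz)
    have := (Finset.sum_eq_zero_iff_of_nonneg hterm).1 (hw y) x (Finset.mem_univ _)
    exact (mul_pos hx hxy).ne' this
  induction hirr z₀ z with
  | refl => exact hz₀
  | tail _ hxy ih => exact step _ _ hxy ih

/-- If `w` is exceeded by `v` anywhere, the positive part of `v - w` is invariant and hence positive
everywhere, which contradicts the equal sums. -/
theorem IsRateMatrix.eq_of_isInvariant (hR : IsRateMatrix R) (hirr : IsIrreducible R)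
    {v w : S → ℝ} (hv : IsInvariant R v) (hw : IsInvariant R w) (h : ∑ z, v z = ∑ z, w z) :
    v = w := by
  have key : ∀ v w : S → ℝ, IsInvariant R v → IsInvariant R w → ∑ z, v z = ∑ z, w z →
      ∀ z, v z ≤ w z := by
    intro v w hv hw h z
    by_contra! hz
    have hpos := hR.pos_of_isInvariant hirr (hR.isInvariant_max_zero (hv.sub hw))
      (fun _ => le_max_right _ _) (z₀ := z) (lt_max_of_lt_left (by simpa using hz))
    have hlt : ∀ x, w x < v x := fun x => by
      rcases lt_max_iff.1 (hpos x) with h | h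
      · simpa using h
      · exact absurd h (lt_irrefl _)
    exact (Finset.sum_lt_sum_of_nonempty ⟨z, Finset.mem_univ z⟩ fun x _ => hlt x).ne h.symm
  exact funext fun z => le_antisymm (key v w hv hw h z) (key w v hw hv h.symm z)

/-- Normalized invariant vectors converge when the rate matrices converge to an irreducible one. -/
theorem tendsto_of_isInvariant {ι : Type*} {l : Filter ι} {Q : ι → S → S → ℝ}
    (hQ : ∀ z z', Tendsto (fun x => Q x z z') l (𝓝 (R z z'))) (hR : IsRateMatrix R)
    (hirr : IsIrreducible R) {v : ι → S → ℝ} (hv : ∀ᶠ x in l, v x ∈ stdSimplex ℝ S)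
    (hinv : ∀ᶠ x in l, IsInvariant (Q x) (v x)) {w : S → ℝ} (hw : w ∈ stdSimplex ℝ S)
    (hwR : IsInvariant R w) : Tendsto v l (𝓝 w) := by
  -- By compactness it suffices to identify cluster points; each is the limit along an ultrafilter
  -- and inherits invariance under `R`.
  refine (isCompact_stdSimplex ℝ S).tendsto_nhds_of_unique_mapClusterPt hv fun y hy hcl => ?_
  refine hR.eq_of_isInvariant hirr (fun z' => ?_) hwR (hy.2.trans hw.2.symm)
  obtain ⟨U, hU, hUy⟩ := mapClusterPt_iff_ultrafilter.1 hcl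
  have h1 : Tendsto (fun x => ∑ z, v x z * Q x z z') U (𝓝 (∑ z, y z * R z z')) :=
    tendsto_finsetSum _ fun z _ => ((tendsto_pi_nhds.1 hUy) z).mul ((hQ z z').mono_left hU)
  have h2 : Tendsto (fun x => ∑ z, v x z * Q x z z') U (𝓝 0) :=
    tendsto_const_nhds.congr' (by
      filter_upwards [hU hinv] with x hx using (hx z').symm)
  exact tendsto_nhds_unique h1 h2

end RateMatrix

/-! ### Stationary distributions with small exit probabilities -/

section SmallExit

variable {S : Type*} [Fintype S] [DecidableEq S] {P : S → S → ℝ}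

/-- The generator `P - 1` of a transition matrix, with the rows scaled by `c`. -/
def scaledGenerator (c : S → ℝ) (P : S → S → ℝ) (z z' : S) : ℝ :=
  c z * (P z z' - if z = z' then 1 else 0)

theorem isRateMatrix_scaledGenerator {c : S → ℝ} (hc : ∀ z, 0 ≤ c z) (hP : ∀ z z', 0 ≤ P z z')
    (hrow : ∀ z, ∑ z', P z z' = 1) : IsRateMatrix (scaledGenerator c P) where
  offDiag_nonneg z z' h := by simpa [scaledGenerator, h] using mul_nonneg (hc z) (hP z z')
  row_sum z := by simp [scaledGenerator, ← Finset.mul_sum, Finset.sum_sub_distrib, hrow]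

theorem isStationary_iff {μ : S → ℝ} :
    IsStationary P μ ↔ μ ∈ stdSimplex ℝ S ∧ IsInvariant (scaledGenerator 1 P) μ := by
  have : IsInvariant (scaledGenerator 1 P) μ ↔ ∀ z', ∑ z, μ z * P z z' = μ z' := by
    refine forall_congr' fun z' => ?_
    simp [scaledGenerator, mul_sub, Finset.sum_sub_distrib, sub_eq_zero]
  rw [this]
  exact and_assoc.symm

omit [Fintype S] in
theorem isIrreducible_scaledGenerator_one (hP : ∀ z z', 0 < P z z') :
    IsIrreducible (scaledGenerator 1 P) := fun z z' => by
  by_cases h : z = z'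
  · rw [h]
  · exact Relation.ReflTransGen.single (by simpa [scaledGenerator, h] using hP z z')

/-- A positive stochastic matrix has exactly one stationary distribution. -/
theorem existsUnique_isStationary [Nonempty S] (hP : ∀ z z', 0 < P z z')
    (hrow : ∀ z, ∑ z', P z z' = 1) : ∃! μ, IsStationary P μ := by
  have hR := isRateMatrix_scaledGenerator (c := 1) (fun _ => zero_le_one)
    (fun z z' => (hP z z').le) hrow
  obtain ⟨v, hv, hinv⟩ := hR.exists_isInvariant
  refine ⟨v, isStationary_iff.2 ⟨hv, hinv⟩, fun w hw => ?_⟩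
  obtain ⟨hw1, hw2⟩ := isStationary_iff.1 hw
  exact hR.eq_of_isInvariant (isIrreducible_scaledGenerator_one hP) hw2 hinv
    (hw1.2.trans hv.2.symm)

/-- If the chain `P ξ` leaves every state `z` at rates of order `ξ ^ ρ z`, and the limits of the
rescaled rates are irreducible, then its stationary distributions concentrate on the states with
maximal `ρ`. -/
theorem exists_tendsto_stationary [Nonempty S] {P : ℝ → S → S → ℝ}
    (hP : ∀ ξ ∈ Ioo (0 : ℝ) 1, ∀ z z', 0 ≤ P ξ z z')
    (hrow : ∀ ξ ∈ Ioo (0 : ℝ) 1, ∀ z, ∑ z', P ξ z z' = 1) (ρ : S → ℝ) (edge : S → S → Prop)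
    (hlim : ∀ z z', z ≠ z' → ∃ l, Tendsto (fun ξ : ℝ => ξ ^ (-ρ z) * P ξ z z') (𝓝[>] 0) (𝓝 l) ∧
      (edge z z' → 0 < l))
    (hconn : ∀ z z', Relation.ReflTransGen edge z z') {μ : ℝ → S → ℝ}
    (hμ : IsStationaryFamily P μ) (z : S) :
    ∃ l, Tendsto (fun ξ => μ ξ z) (𝓝[>] 0) (𝓝 l) ∧ (0 < l ↔ ∀ w, ρ w ≤ ρ z) := by
  set L : Filter ℝ := 𝓝[>] 0
  have hI : ∀ᶠ ξ : ℝ in L, ξ ∈ Ioo (0 : ℝ) 1 := Ioo_mem_nhdsGT one_pos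
  let c : ℝ → S → ℝ := fun ξ z => ξ ^ (-ρ z)
  have hex : ∀ z z', ∃ r, Tendsto (fun ξ => scaledGenerator (c ξ) (P ξ) z z') L (𝓝 r) ∧
      (z ≠ z' → edge z z' → 0 < r) := by
    have hoff : ∀ z z', z ≠ z' →
        ∃ r, Tendsto (fun ξ => scaledGenerator (c ξ) (P ξ) z z') L (𝓝 r) ∧
          (z ≠ z' → edge z z' → 0 < r) := fun z z' h => by
      obtain ⟨l, hl, hl'⟩ := hlim z z' h
      exact ⟨l, by simpa [scaledGenerator, h, c] using hl, fun _ => hl'⟩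
    intro z z'
    by_cases h : z = z'
    · subst h
      choose! r hr _ using hoff z
      -- The diagonal limit is forced by the vanishing row sums.
      refine ⟨-∑ y ∈ Finset.univ.erase z, r y, ?_, fun h => absurd rfl h⟩
      refine (tendsto_finsetSum _ fun y hy =>
        hr y (Finset.ne_of_mem_erase hy).symm).neg.congr' ?_
      filter_upwards [hI] with ξ hξ
      have hR := isRateMatrix_scaledGenerator (c := c ξ)
        (fun z => Real.rpow_nonneg hξ.1.le _) (hP ξ hξ) (hrow ξ hξ)
      have := hR.row_sum z
      rw [← Finset.add_sum_erase _ _ (Finset.mem_univ z)] at this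
      linarith
    · exact hoff z z' h
  choose R hR hRedge using hex
  have hrate : IsRateMatrix R := by
    refine ⟨fun z z' h => ge_of_tendsto (hR z z') ?_, fun z => ?_⟩
    · filter_upwards [hI] with ξ hξ
      exact (isRateMatrix_scaledGenerator (c := c ξ)
        (fun z => Real.rpow_nonneg hξ.1.le _) (hP ξ hξ) (hrow ξ hξ)).offDiag_nonneg z z' h
    · refine tendsto_nhds_unique (tendsto_finsetSum Finset.univ fun z' _ => hR z z')
        (tendsto_const_nhds.congr' ?_)
      filter_upwards [hI] with ξ hξ
      exact ((isRateMatrix_scaledGenerator (c := c ξ)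
        (fun z => Real.rpow_nonneg hξ.1.le _) (hP ξ hξ) (hrow ξ hξ)).row_sum z).symm
  have hirr : IsIrreducible R := fun z z' => by
    induction hconn z z' with
    | refl => exact .refl
    | @tail x y _ hxy ih =>
      by_cases h : x = y
      · exact h ▸ ih
      · exact ih.tail (hRedge x y h hxy)
  obtain ⟨w, hw, hwR⟩ := hrate.exists_isInvariant
  have hwpos : ∀ z, 0 < w z := by
    have : ∃ z, 0 < w z := by
      by_contra! h
      have := Finset.sum_nonpos fun z (_ : z ∈ Finset.univ) => h z
      rw [hw.2] at this
      exact absurd this (by norm_num)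
    obtain ⟨z₀, hz₀⟩ := this
    exact hrate.pos_of_isInvariant hirr hwR hw.1 hz₀
  obtain ⟨zm, hzm⟩ := Finite.exists_max ρ
  -- The rescaled stationary measure converges to the invariant vector of the limit.
  let Z : ℝ → ℝ := fun ξ => ∑ z, ξ ^ ρ z * μ ξ z
  let v : ℝ → S → ℝ := fun ξ z => (Z ξ)⁻¹ * (ξ ^ ρ z * μ ξ z)
  have hZ : ∀ ξ ∈ Ioo (0 : ℝ) 1, 0 < Z ξ := fun ξ hξ => by
    obtain ⟨h0, h1, -⟩ := hμ ξ hξ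
    have : ∃ z, 0 < μ ξ z := by
      by_contra! h
      have := Finset.sum_nonpos fun z (_ : z ∈ Finset.univ) => h z
      rw [h1] at this
      exact absurd this (by norm_num)
    obtain ⟨z, hz⟩ := this
    exact Finset.sum_pos' (fun z _ => mul_nonneg (Real.rpow_nonneg hξ.1.le _) (h0 z))
      ⟨z, Finset.mem_univ _, mul_pos (Real.rpow_pos_of_pos hξ.1 _) hz⟩
  have hv : ∀ᶠ ξ in L, v ξ ∈ stdSimplex ℝ S := by
    filter_upwards [hI] with ξ hξ
    refine ⟨fun z => mul_nonneg (inv_nonneg.2 (hZ ξ hξ).le)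
      (mul_nonneg (Real.rpow_nonneg hξ.1.le _) ((hμ ξ hξ).1 z)), ?_⟩
    simp only [v, ← Finset.mul_sum]
    exact inv_mul_cancel₀ (hZ ξ hξ).ne'
  have hinv : ∀ᶠ ξ in L, IsInvariant (scaledGenerator (c ξ) (P ξ)) (v ξ) := by
    filter_upwards [hI] with ξ hξ z'
    have := (isStationary_iff.1 (hμ ξ hξ)).2 z'
    have h2 : ∀ z, v ξ z * scaledGenerator (c ξ) (P ξ) z z'
        = (Z ξ)⁻¹ * (μ ξ z * scaledGenerator 1 (P ξ) z z') := fun z => by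
      have h3 : ξ ^ ρ z * ξ ^ (-ρ z) = 1 := by
        rw [← Real.rpow_add hξ.1]; simp
      simp only [v, scaledGenerator, c, Pi.one_apply, one_mul]
      linear_combination (Z ξ)⁻¹ * μ ξ z * (P ξ z z' - if z = z' then 1 else 0) * h3
    simp_rw [h2, ← Finset.mul_sum, this, mul_zero]
  have hvw := tendsto_pi_nhds.1 (tendsto_of_isInvariant hR hrate hirr hv hinv hw hwR)
  -- `d ξ` is again proportional to `μ ξ`, but now every entry has a finite limit and at least one
  -- limit is positive, so normalizing commutes with the limit.
  let d : ℝ → S → ℝ := fun ξ z => v ξ z * ξ ^ (ρ zm - ρ z)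
  let d₀ : S → ℝ := fun z => if ρ z = ρ zm then w z else 0
  have hd : ∀ z, Tendsto (fun ξ => d ξ z) L (𝓝 (d₀ z)) := fun z => by
    by_cases h : ρ z = ρ zm
    · simpa [d, d₀, h] using hvw z
    · have hlt : 0 < ρ zm - ρ z := sub_pos.2 (lt_of_le_of_ne (hzm z) h)
      have h1 : Tendsto (fun ξ : ℝ => ξ ^ (ρ zm - ρ z)) L (𝓝 0) := by
        have := (Real.continuousAt_rpow_const 0 (ρ zm - ρ z) (Or.inr hlt.le)).tendsto
        rw [Real.zero_rpow hlt.ne'] at this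
        exact this.mono_left nhdsWithin_le_nhds
      simpa [d, d₀, h] using (hvw z).mul h1
  have hd₀ : 0 < ∑ z, d₀ z := by
    refine Finset.sum_pos' (fun z _ => ?_) ⟨zm, Finset.mem_univ _, by simpa [d₀] using hwpos zm⟩
    simp only [d₀]; split_ifs
    exacts [(hwpos z).le, le_rfl]
  refine ⟨d₀ z / ∑ z, d₀ z, ?_, ?_⟩
  · refine ((hd z).div (tendsto_finsetSum Finset.univ fun z _ => hd z) hd₀.ne').congr' ?_
    filter_upwards [hI] with ξ hξ
    have h1 : ∀ z, d ξ z = (Z ξ)⁻¹ * ξ ^ ρ zm * μ ξ z := fun z => by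
      have : ξ ^ ρ zm = ξ ^ ρ z * ξ ^ (ρ zm - ρ z) := by
        rw [← Real.rpow_add hξ.1]; simp
      simp only [d, v]
      rw [this]; ring
    have h2 : (Z ξ)⁻¹ * ξ ^ ρ zm ≠ 0 :=
      mul_ne_zero (inv_ne_zero (hZ ξ hξ).ne') (Real.rpow_pos_of_pos hξ.1 _).ne'
    change d ξ z / ∑ z, d ξ z = μ ξ z
    simp_rw [h1, ← Finset.mul_sum, (hμ ξ hξ).2.1, mul_one]
    rw [mul_div_cancel_left₀ _ h2]
  · by_cases h : ρ z = ρ zm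
    · have h1 : 0 < d₀ z := by simpa [d₀, h] using hwpos z
      exact ⟨fun _ w => h ▸ hzm w, fun _ => div_pos h1 hd₀⟩
    · simp only [d₀, h, if_false, zero_div, lt_irrefl, false_iff, not_forall, not_le]
      exact ⟨zm, lt_of_le_of_ne (hzm z) h⟩

end SmallExit

end

section

/-! ### Concentration of finite samples -/

section Sampling

variable {Ω : Type*} [Fintype Ω]

open scoped Classical in
/-- The probability of an event under `T` independent draws from the weights `w`. -/
def sampleProb (w : Ω → ℝ) (T : ℕ) (s : (Fin T → Ω) → Prop) : ℝ :=
  ∑ a : Fin T → Ω, (∏ t, w (a t)) * if s a then 1 else 0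

variable {w : Ω → ℝ} {T : ℕ}

theorem sum_prod_weight_eq_one (hw : ∑ x, w x = 1) (T : ℕ) :
    ∑ a : Fin T → Ω, ∏ t, w (a t) = 1 := by
  rw [← Fintype.sum_pow, hw, one_pow]

theorem sampleProb_mono (hw : ∀ x, 0 ≤ w x) {s s' : (Fin T → Ω) → Prop} (h : ∀ a, s a → s' a) :
    sampleProb w T s ≤ sampleProb w T s' := by
  refine Finset.sum_le_sum fun a _ =>
    mul_le_mul_of_nonneg_left ?_ (Finset.prod_nonneg fun t _ => hw _)
  by_cases h1 : s a
  · simp [h1, h a h1]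
  · simp only [h1, if_false]; positivity

open scoped Classical in
theorem sampleProb_exists_le (hw : ∀ x, 0 ≤ w x) {κ : Type*} [Fintype κ]
    (s : κ → (Fin T → Ω) → Prop) :
    sampleProb w T (fun a => ∃ k, s k a) ≤ ∑ k, sampleProb w T (s k) := by
  unfold sampleProb
  rw [Finset.sum_comm]
  refine Finset.sum_le_sum fun a _ => ?_
  rw [← Finset.mul_sum]
  refine mul_le_mul_of_nonneg_left ?_ (Finset.prod_nonneg fun t _ => hw _)
  split_ifs with h
  · obtain ⟨k, hk⟩ := h
    refine le_trans ?_ (Finset.single_le_sum (f := fun k => if s k a then (1 : ℝ) else 0)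
      (fun k _ => by positivity) (Finset.mem_univ k))
    simp [hk]
  · exact Finset.sum_nonneg fun k _ => by positivity

theorem sampleProb_or_le (hw : ∀ x, 0 ≤ w x) (s s' : (Fin T → Ω) → Prop) :
    sampleProb w T (fun a => s a ∨ s' a) ≤ sampleProb w T s + sampleProb w T s' := by
  unfold sampleProb
  rw [← Finset.sum_add_distrib]
  refine Finset.sum_le_sum fun a _ => ?_
  rw [← mul_add]
  refine mul_le_mul_of_nonneg_left ?_ (Finset.prod_nonneg fun t _ => hw _)
  by_cases h : s a <;> by_cases h' : s' a <;> simp [h, h']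

/-- Hoeffding's lemma for a finitely supported random variable with values in `[0, 1]`. -/
theorem sum_mul_exp_le (hw : w ∈ stdSimplex ℝ Ω) {X : Ω → ℝ} (hX : ∀ x, X x ∈ Icc (0 : ℝ) 1)
    (s : ℝ) : ∑ x, w x * Real.exp (s * (X x - ∑ y, w y * X y)) ≤ Real.exp (s ^ 2 / 8) := by
  let _ : MeasurableSpace Ω := ⊤
  have hsum : ∑ x, ENNReal.ofReal (w x) = 1 := by
    rw [← ENNReal.ofReal_sum_of_nonneg fun x _ => hw.1 x, hw.2, ENNReal.ofReal_one]
  let p : PMF Ω := PMF.ofFintype (fun x => ENNReal.ofReal (w x)) hsum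
  have hp : ∀ x, (p x).toReal = w x := fun x => by
    simp [p, PMF.ofFintype_apply, ENNReal.toReal_ofReal (hw.1 x)]
  have h := (ProbabilityTheory.hasSubgaussianMGF_of_mem_Icc (μ := p.toMeasure) (X := X)
    (a := 0) (b := 1) (measurable_of_finite X).aemeasurable (Eventually.of_forall hX)).mgf_le s
  rw [ProbabilityTheory.mgf, PMF.integral_eq_sum, PMF.integral_eq_sum] at h
  simp only [hp, smul_eq_mul] at h
  refine h.trans_eq ?_
  congr 1
  simp
  ring

theorem sampleProb_mean_le (hw : w ∈ stdSimplex ℝ Ω) {X : Ω → ℝ}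
    (hX : ∀ x, X x ∈ Icc (0 : ℝ) 1) (hT : 0 < T) {h : ℝ} (hh : 0 ≤ h) :
    sampleProb w T (fun a => h ≤ 1 / (T : ℝ) * ∑ t, X (a t) - ∑ y, w y * X y) ≤
      Real.exp (-2 * T * h ^ 2) := by
  set p := ∑ y, w y * X y
  have hT' : (0 : ℝ) < T := by exact_mod_cast hT
  -- Chernoff's bound with exponent `s = 4h`, the minimizer of `s² / 8 - s h`.
  have h1 : ∀ a : Fin T → Ω,
      (∏ t, w (a t)) * (if h ≤ 1 / (T : ℝ) * ∑ t, X (a t) - p then (1 : ℝ) else 0) ≤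
        (∏ t, w (a t) * Real.exp (4 * h * (X (a t) - p))) * Real.exp (-4 * T * h ^ 2) := by
    intro a
    rw [Finset.prod_mul_distrib, mul_assoc]
    refine mul_le_mul_of_nonneg_left ?_ (Finset.prod_nonneg fun t _ => hw.1 _)
    rw [← Real.exp_sum, ← Real.exp_add]
    split_ifs with hc
    · refine Real.one_le_exp ?_
      rw [← Finset.mul_sum, Finset.sum_sub_distrib]
      simp only [Finset.sum_const, Finset.card_univ, Fintype.card_fin, nsmul_eq_mul]
      have : T * h ≤ ∑ t, X (a t) - T * p := by
        calc T * h ≤ T * (1 / (T : ℝ) * ∑ t, X (a t) - p) := by gcongr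
          _ = _ := by field_simp
      nlinarith
    · positivity
  calc sampleProb w T (fun a => h ≤ 1 / (T : ℝ) * ∑ t, X (a t) - p)
      ≤ ∑ a : Fin T → Ω,
        (∏ t, w (a t) * Real.exp (4 * h * (X (a t) - p))) * Real.exp (-4 * T * h ^ 2) := by
        refine Finset.sum_le_sum fun a _ => ?_
        convert h1 a
    _ = (∑ x, w x * Real.exp (4 * h * (X x - p))) ^ T * Real.exp (-4 * T * h ^ 2) := by
        rw [← Finset.sum_mul, Fintype.sum_pow]
    _ ≤ Real.exp ((4 * h) ^ 2 / 8) ^ T * Real.exp (-4 * T * h ^ 2) := by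
        gcongr
        · exact Finset.sum_nonneg fun x _ => mul_nonneg (hw.1 x) (Real.exp_pos _).le
        · exact sum_mul_exp_le hw hX _
    _ = Real.exp (-2 * T * h ^ 2) := by
        rw [← Real.exp_nat_mul, ← Real.exp_add]; ring_nf

theorem sampleProb_abs_mean_le (hw : w ∈ stdSimplex ℝ Ω) {X : Ω → ℝ}
    (hX : ∀ x, X x ∈ Icc (0 : ℝ) 1) (hT : 0 < T) {h : ℝ} (hh : 0 ≤ h) :
    sampleProb w T (fun a => h ≤ |1 / (T : ℝ) * ∑ t, X (a t) - ∑ y, w y * X y|) ≤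
      2 * Real.exp (-2 * T * h ^ 2) := by
  have hT' : (T : ℝ) ≠ 0 := by exact_mod_cast hT.ne'
  have h1 := sampleProb_mean_le hw hX hT hh
  have h2 := sampleProb_mean_le hw (X := fun x => 1 - X x)
    (fun x => ⟨by linarith [(hX x).2], by linarith [(hX x).1]⟩) hT hh
  rw [two_mul]
  refine le_trans (le_trans (sampleProb_mono hw.1 fun a ha => ?_) (sampleProb_or_le hw.1 _ _))
    (add_le_add h1 h2)
  rcases le_abs.1 ha with h | h
  · exact Or.inl h
  · right
    simp only [mul_sub, mul_one, Finset.sum_sub_distrib, hw.2, Finset.sum_const, Finset.card_univ,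
      Fintype.card_fin, nsmul_eq_mul, one_div, inv_mul_cancel₀ hT'] at h ⊢
    linarith

end Sampling

/-! ### The error probabilities of the test -/

/-- Induction with `a + b ≤ a b` for `a, b ≥ 2`; this fails for factors equal to one, which
therefore do not enter the sum. It bounds the number of relevant coordinates of the opponents'
profile by the number of their joint actions. -/
theorem sum_ite_two_le_prod {ι : Type*} (s : Finset ι) {n : ι → ℕ} (hn : ∀ j, 1 ≤ n j) :
    ∑ j ∈ s, (if 2 ≤ n j then n j else 0) ≤ ∏ j ∈ s, n j := by
  classical
  induction s using Finset.induction_on with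
  | empty => simp
  | insert j s hj ih =>
    rw [Finset.sum_insert hj, Finset.prod_insert hj]
    have hP : 0 < ∏ k ∈ s, n k := Finset.prod_pos fun k _ => hn k
    split_ifs with h2
    · rcases Nat.eq_zero_or_pos (∑ j ∈ s, (if 2 ≤ n j then n j else 0)) with h0 | h0
      · rw [h0]; nlinarith
      · have : 2 ≤ ∑ j ∈ s, (if 2 ≤ n j then n j else 0) := by
          obtain ⟨k, hk, hk0⟩ := Finset.exists_ne_zero_of_sum_ne_zero h0.ne'
          refine le_trans ?_ (Finset.single_le_sum (f := fun j => if 2 ≤ n j then n j else 0)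
            (fun _ _ => Nat.zero_le _) hk)
          split_ifs at hk0 ⊢ with h
          · exact h
          · exact absurd rfl hk0
        nlinarith
    · rw [zero_add]
      exact ih.trans (Nat.le_mul_of_pos_left _ (hn j))

variable {I : Type*} [Fintype I] [DecidableEq I]
variable {A : I → Type*} [∀ i, Fintype (A i)]

/-! ### Product distributions and distances of profiles -/

theorem prodWeight_mem_stdSimplex {π : ∀ j, A j → ℝ} (hπ : ∀ j, π j ∈ stdSimplex ℝ (A j)) :
    (fun x : ∀ j, A j => ∏ j, π j (x j)) ∈ stdSimplex ℝ (∀ j, A j) := by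
  refine ⟨fun x => Finset.prod_nonneg fun j _ => (hπ j).1 _, ?_⟩
  rw [← Fintype.prod_sum]
  exact Finset.prod_eq_one fun j _ => (hπ j).2

theorem sum_prodWeight_mul_ite {π : ∀ j, A j → ℝ} (hπ : ∀ j, π j ∈ stdSimplex ℝ (A j)) (k : I)
    (g : A k → ℝ) :
    ∑ x : ∀ j, A j, (∏ j, π j (x j)) * g (x k) = ∑ c, π k c * g c := by
  have h1 : ∀ x : ∀ j, A j, (∏ j, π j (x j)) * g (x k)
      = ∏ j, (π j (x j) * if h : j = k then g (h ▸ x j) else 1) := fun x => by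
    rw [Finset.prod_mul_distrib]
    congr 1
    rw [Finset.prod_eq_single k (fun j _ hj => by simp [hj]) (by simp)]
    simp
  simp_rw [h1]
  rw [← Fintype.prod_sum (fun j c => π j c * if h : j = k then g (h ▸ c) else 1),
    Finset.prod_eq_single k (fun j _ hj => by simpa [hj] using (hπ j).2) (by simp)]
  simp

theorem profDist_comm {i : I} (p q : ∀ j : {j : I // j ≠ i}, A j → ℝ) :
    profDist p q = profDist q p := by
  unfold profDist
  simp_rw [sub_sq_comm]

/-- The profile distance as a Euclidean distance. -/
theorem profDist_eq_dist {i : I} (p q : ∀ j : {j : I // j ≠ i}, A j → ℝ) :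
    profDist p q = dist (WithLp.toLp 2 fun x : (Σ j : {j : I // j ≠ i}, A j) => p x.1 x.2)
      (WithLp.toLp 2 fun x : (Σ j : {j : I // j ≠ i}, A j) => q x.1 x.2) := by
  rw [EuclideanSpace.dist_eq, profDist, Fintype.sum_sigma]
  simp [Real.dist_eq, sq_abs]

theorem profDist_triangle {i : I} (p q r : ∀ j : {j : I // j ≠ i}, A j → ℝ) :
    profDist p r ≤ profDist p q + profDist q r := by
  simp only [profDist_eq_dist]
  exact dist_triangle _ _ _

theorem stratDist_le_profDist {i : I} (p q : ∀ j : {j : I // j ≠ i}, A j → ℝ)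
    (j : {j : I // j ≠ i}) : stratDist (p j) (q j) ≤ profDist p q :=
  Real.sqrt_le_sqrt (Finset.single_le_sum (f := fun j => ∑ c, (p j c - q j c) ^ 2)
    (fun _ _ => Finset.sum_nonneg fun _ _ => sq_nonneg _) (Finset.mem_univ j))

theorem stratDist_comm {α : Type*} [Fintype α] (p q : α → ℝ) : stratDist p q = stratDist q p := by
  unfold stratDist
  simp_rw [sub_sq_comm]

theorem eq_one_of_mem_stdSimplex_of_card_le_one {α : Type*} [Fintype α] {p : α → ℝ}
    (hp : p ∈ stdSimplex ℝ α) (h : Fintype.card α ≤ 1) (c : α) : p c = 1 := by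
  have := Fintype.card_le_one_iff_subsingleton.1 h
  rw [← hp.2]
  exact (Fintype.sum_subsingleton _ c).symm

omit [Fintype I] [DecidableEq I] in
theorem empirical_mem_stdSimplex [∀ i, DecidableEq (A i)] {T : ℕ} (hT : 0 < T) {i : I}
    (a : Fin T → ∀ j : {j : I // j ≠ i}, A j) (j : {j : I // j ≠ i}) :
    empirical a j ∈ stdSimplex ℝ (A j) := by
  have hT' : (T : ℝ) ≠ 0 := by exact_mod_cast hT.ne'
  refine ⟨fun c => ?_, ?_⟩
  · unfold empirical; positivity
  · unfold empirical
    rw [← Finset.mul_sum, Finset.sum_comm]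
    simp [hT']

/-- The total number of actions of the opponents of player `i` that have a choice. -/
def nontrivialCard (A : I → Type*) [∀ i, Fintype (A i)] (i : I) : ℕ :=
  ∑ j : {j : I // j ≠ i} with 2 ≤ Fintype.card (A j.1), Fintype.card (A j)

theorem oppCard_eq_prod (i : I) :
    oppCard A i = ∏ j : {j : I // j ≠ i}, Fintype.card (A j) := by
  simp [oppCard, Fintype.card_pi]

theorem oppCard_pos [∀ i, Nonempty (A i)] (i : I) : 0 < oppCard A i := by
  rw [oppCard_eq_prod]; exact Finset.prod_pos fun j _ => Fintype.card_pos

theorem nontrivialCard_le_oppCard [∀ i, Nonempty (A i)] (i : I) :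
    nontrivialCard A i ≤ oppCard A i := by
  rw [nontrivialCard, Finset.sum_filter, oppCard_eq_prod]
  exact sum_ite_two_le_prod _ fun j : {j : I // j ≠ i} => Fintype.card_pos (α := A j)

/-- Two strategies over a single action coincide, so opponents without a choice drop out of every
distance. Without this reduction the number of coordinates could exceed `|A_{-i}|`. -/
theorem sum_sum_eq_sum_nontrivial {i : I} {g : ∀ j : {j : I // j ≠ i}, A j → ℝ}
    (hg : ∀ j : {j : I // j ≠ i}, Fintype.card (A j) ≤ 1 → ∀ c, g j c = 0) :
    ∑ j, ∑ c, g j c = ∑ j with 2 ≤ Fintype.card (A j.1), ∑ c, g j c := by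
  refine (Finset.sum_subset (Finset.subset_univ _) fun j _ hj => ?_).symm
  have hj' : Fintype.card (A j) ≤ 1 := by
    simp only [Finset.mem_filter, Finset.mem_univ, true_and] at hj; omega
  exact Finset.sum_eq_zero fun c _ => hg j hj' c

omit [Fintype I] [DecidableEq I] in
theorem profile_eq_of_card_le_one {i : I} {p q : ∀ j : {j : I // j ≠ i}, A j → ℝ}
    (hp : ∀ j : {j : I // j ≠ i}, p j ∈ stdSimplex ℝ (A j))
    (hq : ∀ j : {j : I // j ≠ i}, q j ∈ stdSimplex ℝ (A j)) (j : {j : I // j ≠ i})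
    (hj : Fintype.card (A j) ≤ 1) (c : A j) : p j c = q j c := by
  rw [eq_one_of_mem_stdSimplex_of_card_le_one (hp j) hj,
    eq_one_of_mem_stdSimplex_of_card_le_one (hq j) hj]

/-- A large distance of two profiles is visible in a single coordinate. -/
theorem exists_le_abs_sub_of_le_profDist [∀ i, Nonempty (A i)] {i : I}
    {p q : ∀ j : {j : I // j ≠ i}, A j → ℝ}
    (hp : ∀ j : {j : I // j ≠ i}, p j ∈ stdSimplex ℝ (A j))
    (hq : ∀ j : {j : I // j ≠ i}, q j ∈ stdSimplex ℝ (A j)) {h : ℝ} (hh : 0 < h)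
    (hd : Real.sqrt (oppCard A i * h ^ 2) ≤ profDist p q) :
    ∃ x : Σ j : {j : I // j ≠ i}, A j, h ≤ |p x.1 x.2 - q x.1 x.2| := by
  have hopos : (0 : ℝ) < oppCard A i := by exact_mod_cast oppCard_pos i
  have hd' := (Real.sqrt_le_sqrt_iff (Finset.sum_nonneg fun _ _ => Finset.sum_nonneg
      fun _ _ => sq_nonneg _)).1 hd
  rw [sum_sum_eq_sum_nontrivial fun j hj c => by
    rw [profile_eq_of_card_le_one hp hq j hj, sub_self, zero_pow two_ne_zero]] at hd'
  set s := Finset.univ.filter fun j : {j : I // j ≠ i} => 2 ≤ Fintype.card (A j)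
  have hle : ∑ j ∈ s, ∑ _c : A j, h ^ 2 ≤ oppCard A i * h ^ 2 := by
    simp only [Finset.sum_const, Finset.card_univ, nsmul_eq_mul, ← Finset.sum_mul]
    refine mul_le_mul_of_nonneg_right ?_ (sq_nonneg h)
    exact_mod_cast nontrivialCard_le_oppCard (A := A) i
  -- If no opponent had a choice, the distance would be zero, against `h > 0`.
  have hne : s.Nonempty := by
    by_contra hs
    rw [Finset.not_nonempty_iff_eq_empty.1 hs, Finset.sum_empty] at hd'
    exact absurd hd' (not_le.2 (by positivity))
  obtain ⟨j, -, hj⟩ := Finset.exists_le_of_sum_le hne (hle.trans hd')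
  obtain ⟨c, -, hc⟩ := Finset.exists_le_of_sum_le Finset.univ_nonempty hj
  exact ⟨⟨j, c⟩, by simpa [abs_of_pos hh] using sq_le_sq.1 hc⟩

/-- The empirical profile is close to the true one. -/
theorem sampleProb_profDist_le [∀ i, DecidableEq (A i)] [∀ i, Nonempty (A i)] {π : ∀ j, A j → ℝ}
    (hπ : ∀ j, π j ∈ stdSimplex ℝ (A j)) {T : ℕ} (hT : 0 < T) {α : ℝ} (hα : α ∈ Ioo (0 : ℝ) 1)
    (i : I) :
    sampleProb (fun x : ∀ j, A j => ∏ j, π j (x j)) T (fun a =>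
        Real.sqrt ((oppCard A i : ℝ) / (2 * (T : ℝ)) * Real.log (2 / α)) ≤
          profDist (empirical fun t (j : {j : I // j ≠ i}) => a t j.1) fun j => π j) ≤
      Fintype.card (Σ j : {j : I // j ≠ i}, A j) * α := by
  have hT' : (0 : ℝ) < T := by exact_mod_cast hT
  have hlog : 0 < Real.log (2 / α) := Real.log_pos (by rw [lt_div_iff₀ hα.1]; linarith [hα.2])
  -- With this `h`, Hoeffding's bound `2 exp(-2 T h²)` equals `α`, and `|A_{-i}| h²` is the square
  -- of the margin of the test.
  set h := Real.sqrt (Real.log (2 / α) / (2 * T))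
  have hsq : h ^ 2 = Real.log (2 / α) / (2 * T) := Real.sq_sqrt (by positivity)
  have hh : 0 < h := Real.sqrt_pos.2 (by positivity)
  have hw := prodWeight_mem_stdSimplex hπ
  have hb : ∀ x : (Σ j : {j : I // j ≠ i}, A j),
      sampleProb (fun x : ∀ j, A j => ∏ j, π j (x j)) T (fun a =>
        h ≤ |empirical (fun t (j : {j : I // j ≠ i}) => a t j.1) x.1 x.2 - π x.1 x.2|) ≤ α := by
    rintro ⟨j, c⟩
    have h1 := sampleProb_abs_mean_le hw (X := fun x => if x j.1 = c then 1 else 0)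
      (fun x => by split_ifs <;> simp) hT hh.le
    rw [sum_prodWeight_mul_ite hπ j.1 fun d => if d = c then 1 else 0, hsq] at h1
    simp only [mul_ite, mul_one, mul_zero, Finset.sum_ite_eq', Finset.mem_univ, if_true] at h1
    refine h1.trans_eq ?_
    have : -2 * (T : ℝ) * (Real.log (2 / α) / (2 * T)) = -Real.log (2 / α) := by field_simp
    rw [this, Real.exp_neg, Real.exp_log (by have := hα.1; positivity)]
    field_simp
  refine le_trans (sampleProb_mono hw.1 fun a ha => ?_) (le_trans (sampleProb_exists_le hw.1
    fun (x : Σ j : {j : I // j ≠ i}, A j) a =>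
      h ≤ |empirical (fun t (j : {j : I // j ≠ i}) => a t j.1) x.1 x.2 - π x.1 x.2|)
    ((Finset.sum_le_sum fun x _ => hb x).trans_eq (by simp)))
  refine exists_le_abs_sub_of_le_profDist (fun j => empirical_mem_stdSimplex hT _ j)
    (fun j => hπ j) hh (le_trans (le_of_eq ?_) ha)
  rw [hsq]; congr 1; ring

/-- With a sufficient sample, the test errs with probability of order `α`. -/
theorem sampleProb_test_error_le [∀ i, DecidableEq (A i)] [∀ i, Nonempty (A i)] {π : ∀ j, A j → ℝ}
    (hπ : ∀ j, π j ∈ stdSimplex ℝ (A j)) {T M : ℕ} (hT : 0 < T) {τ α : ℝ}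
    (hα : α ∈ Ioo (0 : ℝ) 1) (i : I) (b : Belief A M i)
    (hsuff : τ < profDist (fun j => π j) b.prof →
      2 * (oppCard A i : ℝ) / (profDist (fun j => π j) b.prof - τ) ^ 2 * Real.log (2 / α) ≤ T) :
    sampleProb (fun x : ∀ j, A j => ∏ j, π j (x j)) T (fun a =>
        ¬(Rejects τ α b (fun t (j : {j : I // j ≠ i}) => a t j.1) ↔
          ¬ profDist b.prof (fun j => π j) ≤ τ)) ≤
      Fintype.card (Σ j : {j : I // j ≠ i}, A j) * α := by
  have hT' : (0 : ℝ) < T := by exact_mod_cast hT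
  have hlog : 0 < Real.log (2 / α) := Real.log_pos (by rw [lt_div_iff₀ hα.1]; linarith [hα.2])
  refine le_trans (sampleProb_mono (prodWeight_mem_stdSimplex hπ).1 fun a ha => ?_)
    (sampleProb_profDist_le hπ hT hα i)
  set e := empirical fun t (j : {j : I // j ≠ i}) => a t j.1
  set δ := Real.sqrt ((oppCard A i : ℝ) / (2 * (T : ℝ)) * Real.log (2 / α))
  rw [profDist_comm b.prof] at ha
  set d := profDist (fun j : {j : I // j ≠ i} => π j) b.prof
  rcases le_or_gt d τ with hd | hd
  · have hrej : τ + δ < profDist e b.prof := by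
      simpa [hd, Rejects] using ha
    have := profDist_triangle e (fun j => π j) b.prof
    linarith
  · have hrej : profDist e b.prof ≤ τ + δ := by
      simpa [hd, Rejects] using ha
    have htri := profDist_triangle (fun j => π j) e b.prof
    rw [profDist_comm _ e] at htri
    have hs := hsuff hd
    have hdτ : 0 < d - τ := sub_pos.2 hd
    -- This is exactly the sample size condition. A failure to reject then puts the empirical
    -- profile at distance at least `d - τ - δ ≥ δ` from the truth.
    have hδ : δ ≤ (d - τ) / 2 := by
      refine Real.sqrt_le_iff.2 ⟨by positivity, ?_⟩
      rw [div_mul_eq_mul_div, div_le_iff₀ (by positivity)] at hs ⊢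
      nlinarith
    linarith

end

section

/-! ### The softmax function -/

section Softmax

variable {α : Type*} [Fintype α]

/-- The softmax of a vector. -/
def softmax (x : α → ℝ) : α → ℝ :=
  fun c => Real.exp (x c) / ∑ c', Real.exp (x c')

theorem sum_exp_pos [Nonempty α] (x : α → ℝ) : 0 < ∑ c, Real.exp (x c) :=
  Finset.sum_pos (fun _ _ => Real.exp_pos _) Finset.univ_nonempty

theorem softmax_mem_stdSimplex [Nonempty α] (x : α → ℝ) : softmax x ∈ stdSimplex ℝ α := by
  refine ⟨fun c => div_nonneg (Real.exp_pos _).le (sum_exp_pos x).le, ?_⟩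
  simp only [softmax, ← Finset.sum_div]
  exact div_self (sum_exp_pos x).ne'

/-- Numerator and denominator each change by a factor between `e^{-η}` and `e^η`, so the quotient
loses at most the factor `e^{-2η} ≥ 1 - 2η`. -/
theorem abs_softmax_sub_le [Nonempty α] {x y : α → ℝ} {η : ℝ} (h : ∀ c, |x c - y c| ≤ η) (c : α) :
    |softmax x c - softmax y c| ≤ 2 * η := by
  have key : ∀ x y : α → ℝ, (∀ c, |x c - y c| ≤ η) → softmax x c - softmax y c ≤ 2 * η := by
    intro x y h
    have hη : 0 ≤ η := (abs_nonneg _).trans (h c)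
    have hx := softmax_mem_stdSimplex x
    have h1 : softmax x c * Real.exp (-(2 * η)) ≤ softmax y c := by
      have hZ : ∑ c, Real.exp (y c) ≤ Real.exp η * ∑ c, Real.exp (x c) := by
        rw [Finset.mul_sum]
        refine Finset.sum_le_sum fun d _ => ?_
        rw [← Real.exp_add, Real.exp_le_exp]
        linarith [(abs_le.1 (h d)).1]
      have hn : Real.exp (x c) * Real.exp (-η) ≤ Real.exp (y c) := by
        rw [← Real.exp_add, Real.exp_le_exp]
        linarith [(abs_le.1 (h c)).2]
      have he : Real.exp (-(2 * η)) = Real.exp (-η) / Real.exp η := by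
        rw [← Real.exp_sub]; congr 1; ring
      rw [softmax, he, div_mul_div_comm, mul_comm _ (Real.exp η)]
      exact div_le_div₀ (Real.exp_pos _).le hn (sum_exp_pos y) hZ
    have h2 : 1 - 2 * η ≤ Real.exp (-(2 * η)) := by
      have := Real.add_one_le_exp (-(2 * η)); linarith
    have h3 : softmax x c ≤ 1 := by
      rw [← hx.2]; exact Finset.single_le_sum (fun d _ => hx.1 d) (Finset.mem_univ c)
    have h4 : softmax x c * (1 - 2 * η) ≤ softmax x c * Real.exp (-(2 * η)) :=
      mul_le_mul_of_nonneg_left h2 (hx.1 c)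
    nlinarith [hx.1 c]
  rw [abs_le]
  have := key y x fun c => by rw [abs_sub_comm]; exact h c
  exact ⟨by linarith, key x y h⟩

/-- The softmax maximizes expected payoff up to the maximal entropy. -/
theorem sub_log_card_le_sum_softmax [Nonempty α] (x : α → ℝ) (c₀ : α) :
    x c₀ - Real.log (Fintype.card α) ≤ ∑ c, softmax x c * x c := by
  set n : ℝ := ((Fintype.card α : ℕ) : ℝ)
  have hn : 0 < n := Nat.cast_pos.2 Fintype.card_pos
  set Z := ∑ c, Real.exp (x c)
  have hZ : 0 < Z := sum_exp_pos x
  have hp := softmax_mem_stdSimplex x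
  have hpos : ∀ c, 0 < softmax x c := fun c => div_pos (Real.exp_pos _) hZ
  have hZx : x c₀ ≤ Real.log Z := by
    rw [Real.le_log_iff_exp_le hZ]
    exact Finset.single_le_sum (f := fun c => Real.exp (x c)) (fun c _ => (Real.exp_pos _).le)
      (Finset.mem_univ c₀)
  have hlog : ∀ c, Real.log (softmax x c) = x c - Real.log Z := fun c => by
    rw [softmax, Real.log_div (Real.exp_pos _).ne' hZ.ne', Real.log_exp]
  -- The inequality `1 - 1/t ≤ log t` at `t = n * softmax x c`. Summed over `c`, it says that the
  -- relative entropy with respect to the uniform distribution is non-negative.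
  have hterm : ∀ c, softmax x c - n⁻¹ ≤ softmax x c * (x c - Real.log Z + Real.log n) := fun c => by
    have h1 := Real.one_sub_inv_le_log_of_pos (mul_pos (hpos c) hn)
    rw [Real.log_mul (hpos c).ne' hn.ne', hlog] at h1
    have h2 := mul_le_mul_of_nonneg_left h1 (hpos c).le
    have h3 : softmax x c * (1 - (softmax x c * n)⁻¹) = softmax x c - n⁻¹ := by
      have := (hpos c).ne'
      field_simp
    linarith
  have hsum := Finset.sum_le_sum fun c (_ : c ∈ Finset.univ) => hterm c
  have h1 : ∑ c, (softmax x c - n⁻¹) = 0 := by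
    rw [Finset.sum_sub_distrib, hp.2]
    simp [n, hn.ne']
  have h2 : ∑ c, softmax x c * (x c - Real.log Z + Real.log n)
      = ∑ c, softmax x c * x c - Real.log Z + Real.log n := by
    simp only [mul_add, mul_sub, Finset.sum_add_distrib, Finset.sum_sub_distrib, ← Finset.sum_mul,
      hp.2, one_mul]
  rw [h1, h2] at hsum
  linarith

end Softmax

/-! ### Rounding to the grid -/

/-- Round all `M * q c` down. The missing mass is an integer between `0` and the number of actions,
and is restored by adding one unit to that many actions. -/
theorem exists_gridSimplex_near {α : Type*} [Fintype α] {M : ℕ} (hM : 0 < M) {q : α → ℝ}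
    (hq : q ∈ stdSimplex ℝ α) :
    ∃ p : gridSimplex α M, ∀ c, |(p : α → ℝ) c - q c| ≤ 1 / (M : ℝ) := by
  classical
  have hM' : (0 : ℝ) < M := by exact_mod_cast hM
  let n : α → ℕ := fun c => ⌊M * q c⌋₊
  have hn : ∀ c, (n c : ℝ) ≤ M * q c := fun c => Nat.floor_le (mul_nonneg hM'.le (hq.1 c))
  have hn' : ∀ c, M * q c < n c + 1 := fun c => Nat.lt_floor_add_one _
  have hsumq : ∑ c, M * q c = M := by rw [← Finset.mul_sum, hq.2, mul_one]
  have hsum : ∑ c, n c ≤ M := by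
    have : (∑ c, (n c : ℝ)) ≤ M := hsumq ▸ Finset.sum_le_sum fun c _ => hn c
    exact_mod_cast this
  have hcard : M - ∑ c, n c ≤ (Finset.univ : Finset α).card := by
    have : (M : ℝ) ≤ ∑ c, ((n c : ℝ) + 1) := by
      conv_lhs => rw [← hsumq]
      exact Finset.sum_le_sum fun c _ => (hn' c).le
    rw [Finset.sum_add_distrib] at this
    simp only [Finset.sum_const, nsmul_eq_mul, mul_one] at this
    have : M ≤ ∑ c, n c + (Finset.univ : Finset α).card := by exact_mod_cast this
    omega
  obtain ⟨s, -, hs⟩ := Finset.exists_subset_card_eq hcard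
  let m : α → ℕ := fun c => n c + if c ∈ s then 1 else 0
  have hm : ∑ c, m c = M := by
    simp only [m, Finset.sum_add_distrib, Finset.sum_ite_mem, Finset.univ_inter,
      Finset.sum_const, smul_eq_mul, mul_one, hs]
    omega
  refine ⟨⟨fun c => m c / M, fun c => by positivity, ?_, fun c => ⟨m c, ?_, rfl⟩⟩, fun c => ?_⟩
  · rw [← Finset.sum_div, ← Nat.cast_sum, hm, div_self hM'.ne']
  · rw [← hm]; exact Finset.single_le_sum (fun _ _ => Nat.zero_le _) (Finset.mem_univ c)
  · have h1 : (m c : ℝ) / M - q c = (m c - M * q c) / M := by field_simp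
    have h2 : |(m c : ℝ) - M * q c| ≤ 1 := by
      have a := hn c
      have b := hn' c
      simp only [m, abs_le]
      push_cast
      split_ifs <;> constructor <;> linarith
    change |(m c : ℝ) / M - q c| ≤ 1 / M
    rw [h1, abs_div, abs_of_pos hM']
    gcongr

instance {α : Type*} [Fintype α] [Nonempty α] {M : ℕ} [NeZero M] : Nonempty (gridSimplex α M) := by
  classical
  obtain ⟨p, -⟩ := exists_gridSimplex_near (NeZero.pos M) (softmax_mem_stdSimplex (0 : α → ℝ))
  exact ⟨p⟩

theorem mem_stdSimplex_of_gridSimplex {α : Type*} [Fintype α] {M : ℕ} (p : gridSimplex α M) :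
    (p : α → ℝ) ∈ stdSimplex ℝ α := ⟨p.2.1, p.2.2.1⟩

/-! ### Expected payoffs -/

/-- Product distributions are close in total variation if their factors are. -/
theorem sum_abs_prod_sub_prod_le {ι : Type*} [Fintype ι] [DecidableEq ι] {κ : ι → Type*}
    [∀ j, Fintype (κ j)] {p q : ∀ j, κ j → ℝ} (hp : ∀ j, p j ∈ stdSimplex ℝ (κ j))
    (hq : ∀ j, q j ∈ stdSimplex ℝ (κ j)) :
    ∑ a : ∀ j, κ j, |∏ j, p j (a j) - ∏ j, q j (a j)| ≤ ∑ j, ∑ c, |p j c - q j c| := by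
  -- The factors are exchanged one at a time. Each exchange costs the `ℓ¹` distance of the two
  -- factors, because the other factors have total mass one.
  suffices h : ∀ s : Finset ι, ∑ a : ∀ j, κ j,
      |∏ j, (if j ∈ s then p j else q j) (a j) - ∏ j, q j (a j)| ≤
        ∑ j ∈ s, ∑ c, |p j c - q j c| by
    simpa using h Finset.univ
  intro s
  induction s using Finset.induction_on with
  | empty => simp
  | insert k s hk ih =>
    rw [Finset.sum_insert hk]
    set r : ∀ j, κ j → ℝ := fun j => if j ∈ s then p j else q j
    have hr : ∀ j, r j ∈ stdSimplex ℝ (κ j) := fun j => by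
      simp only [r]; split_ifs
      exacts [hp j, hq j]
    have hstep : ∑ a : ∀ j, κ j,
        |∏ j, (if j ∈ insert k s then p j else q j) (a j) - ∏ j, r j (a j)|
          = ∑ c, |p k c - q k c| := by
      have h1 : ∀ a : ∀ j, κ j,
          |∏ j, (if j ∈ insert k s then p j else q j) (a j) - ∏ j, r j (a j)|
            = ∏ j, (fun c => if j = k then |p j c - q j c| else r j c) (a j) := fun a => by
        rw [← Finset.mul_prod_erase _ _ (Finset.mem_univ k),
          ← Finset.mul_prod_erase _ (fun j => r j (a j)) (Finset.mem_univ k),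
          ← Finset.mul_prod_erase _ (fun j =>
            (fun c => if j = k then |p j c - q j c| else r j c) (a j)) (Finset.mem_univ k)]
        have e1 : ∏ j ∈ Finset.univ.erase k, (if j ∈ insert k s then p j else q j) (a j)
            = ∏ j ∈ Finset.univ.erase k, r j (a j) :=
          Finset.prod_congr rfl fun j hj => by
            simp [r, Finset.ne_of_mem_erase hj]
        have e2 : ∏ j ∈ Finset.univ.erase k,
            (fun c => if j = k then |p j c - q j c| else r j c) (a j)
            = ∏ j ∈ Finset.univ.erase k, r j (a j) :=
          Finset.prod_congr rfl fun j hj => by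
            simp [Finset.ne_of_mem_erase hj]
        rw [e1, e2, ← sub_mul, abs_mul,
          abs_of_nonneg (Finset.prod_nonneg fun j _ => (hr j).1 (a j))]
        simp [r, hk]
      simp_rw [h1]
      rw [← Fintype.prod_sum fun j c => if j = k then |p j c - q j c| else r j c,
        Finset.prod_eq_single k (fun j _ hj => by simpa [hj] using (hr j).2)
        (by simp)]
      simp
    calc _ ≤ ∑ a : ∀ j, κ j,
        (|∏ j, (if j ∈ insert k s then p j else q j) (a j) - ∏ j, r j (a j)|
          + |∏ j, r j (a j) - ∏ j, q j (a j)|) :=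
          Finset.sum_le_sum fun a _ => abs_sub_le _ _ _
      _ ≤ _ := by
          rw [Finset.sum_add_distrib, hstep]
          gcongr

variable {I : Type*} [Fintype I] [DecidableEq I]
variable {A : I → Type*} [∀ i, Fintype (A i)]

theorem utilityAgainst_eq_sum (u : I → (∀ j, A j) → ℝ) (i : I) (p : A i → ℝ)
    (q : ∀ j : {j : I // j ≠ i}, A j → ℝ) :
    utilityAgainst u i p q = ∑ c, p c * utilityAction u i c q := by
  unfold utilityAgainst utility utilityAction
  rw [← (Equiv.piSplitAt i A).symm.sum_comp, Fintype.sum_prod_type]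
  refine Finset.sum_congr rfl fun c _ => ?_
  rw [Finset.mul_sum]
  refine Finset.sum_congr rfl fun a _ => ?_
  have h2 : ∏ j, (Equiv.piSplitAt i fun j => A j → ℝ).symm (p, q) j
      ((Equiv.piSplitAt i A).symm (c, a) j) = p c * ∏ j, q j (a j) := by
    rw [Fintype.prod_eq_mul_prod_subtype_ne _ i]
    congr 1
    · simp [Equiv.piSplitAt]
    · refine Finset.prod_congr rfl fun j _ => ?_
      simp [Equiv.piSplitAt, j.2]
  rw [h2]
  ring

theorem utility_update (u : I → (∀ j, A j) → ℝ) (i : I) (π : ∀ j, A j → ℝ) (p : A i → ℝ) :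
    utility u i (Function.update π i p) = utilityAgainst u i p fun j => π j := by
  unfold utilityAgainst
  congr 1

theorem utility_eq_utilityAgainst (u : I → (∀ j, A j) → ℝ) (i : I) (π : ∀ j, A j → ℝ) :
    utility u i π = utilityAgainst u i (π i) fun j => π j := by
  rw [← utility_update, Function.update_eq_self]

theorem abs_le_maxPayoff [Nonempty I] [∀ i, Nonempty (A i)] (u : I → (∀ j, A j) → ℝ) (i : I)
    (a : ∀ j, A j) : |u i a| ≤ maxPayoff u :=
  (Finset.le_sup' (fun a => |u i a|) (Finset.mem_univ a)).trans
    (Finset.le_sup' (fun i => Finset.univ.sup' Finset.univ_nonempty fun a => |u i a|)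
      (Finset.mem_univ i))

theorem maxPayoff_nonneg [Nonempty I] [∀ i, Nonempty (A i)] (u : I → (∀ j, A j) → ℝ) :
    0 ≤ maxPayoff u :=
  (abs_nonneg _).trans (abs_le_maxPayoff u (Classical.arbitrary I) (Classical.arbitrary _))

theorem abs_utility_le [Nonempty I] [∀ i, Nonempty (A i)] (u : I → (∀ j, A j) → ℝ) (i : I)
    {π : ∀ j, A j → ℝ} (hπ : ∀ j, π j ∈ stdSimplex ℝ (A j)) : |utility u i π| ≤ maxPayoff u := by
  have hw := prodWeight_mem_stdSimplex hπ
  calc |utility u i π| ≤ ∑ a : ∀ j, A j, |(∏ j, π j (a j)) * u i a| :=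
        Finset.abs_sum_le_sum_abs _ _
    _ ≤ ∑ a : ∀ j, A j, (∏ j, π j (a j)) * maxPayoff u := by
        refine Finset.sum_le_sum fun a _ => ?_
        rw [abs_mul, abs_of_nonneg (hw.1 a)]
        exact mul_le_mul_of_nonneg_left (abs_le_maxPayoff u i a) (hw.1 a)
    _ = maxPayoff u := by rw [← Finset.sum_mul, hw.2, one_mul]

theorem abs_utilityAction_sub_le [Nonempty I] [∀ i, Nonempty (A i)] (u : I → (∀ j, A j) → ℝ)
    (i : I) (c : A i) {p q : ∀ j : {j : I // j ≠ i}, A j → ℝ}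
    (hp : ∀ j : {j : I // j ≠ i}, p j ∈ stdSimplex ℝ (A j))
    (hq : ∀ j : {j : I // j ≠ i}, q j ∈ stdSimplex ℝ (A j)) :
    |utilityAction u i c p - utilityAction u i c q| ≤
      maxPayoff u * ∑ j, ∑ d, |p j d - q j d| := by
  unfold utilityAction
  rw [← Finset.sum_sub_distrib]
  refine (Finset.abs_sum_le_sum_abs _ _).trans ?_
  refine le_trans ?_ (mul_le_mul_of_nonneg_left (sum_abs_prod_sub_prod_le hp hq)
    (maxPayoff_nonneg u))
  rw [Finset.mul_sum]
  refine Finset.sum_le_sum fun a _ => ?_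
  rw [← mul_sub, abs_mul]
  exact mul_le_mul_of_nonneg_right (abs_le_maxPayoff u i _) (abs_nonneg _)

/-- Cauchy–Schwarz, applied only to the coordinates of opponents with a choice. -/
theorem sum_abs_sub_le_sqrt_mul_profDist {i : I} {p q : ∀ j : {j : I // j ≠ i}, A j → ℝ}
    (hp : ∀ j : {j : I // j ≠ i}, p j ∈ stdSimplex ℝ (A j))
    (hq : ∀ j : {j : I // j ≠ i}, q j ∈ stdSimplex ℝ (A j)) :
    ∑ j, ∑ c, |p j c - q j c| ≤ Real.sqrt (nontrivialCard A i) * profDist p q := by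
  unfold profDist
  rw [← Real.sqrt_mul (Nat.cast_nonneg _)]
  refine Real.le_sqrt_of_sq_le ?_
  rw [sum_sum_eq_sum_nontrivial fun j hj c => by
      rw [profile_eq_of_card_le_one hp hq j hj, sub_self, abs_zero],
    sum_sum_eq_sum_nontrivial fun j hj c => by
      rw [profile_eq_of_card_le_one hp hq j hj, sub_self, zero_pow two_ne_zero],
    Finset.sum_sigma', Finset.sum_sigma']
  refine sq_sum_le_card_mul_sum_sq.trans_eq ?_
  simp [nontrivialCard, Finset.card_sigma, sq_abs]

theorem profDist_le_sqrt_mul {i : I} {p q : ∀ j : {j : I // j ≠ i}, A j → ℝ}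
    (hp : ∀ j : {j : I // j ≠ i}, p j ∈ stdSimplex ℝ (A j))
    (hq : ∀ j : {j : I // j ≠ i}, q j ∈ stdSimplex ℝ (A j)) {x : ℝ} (hx : 0 ≤ x)
    (h : ∀ j c, |p j c - q j c| ≤ x) :
    profDist p q ≤ Real.sqrt (nontrivialCard A i) * x := by
  unfold profDist
  refine Real.sqrt_le_iff.2 ⟨by positivity, ?_⟩
  rw [sum_sum_eq_sum_nontrivial fun j hj c => by
      rw [profile_eq_of_card_le_one hp hq j hj, sub_self, zero_pow two_ne_zero],
    mul_pow, Real.sq_sqrt (Nat.cast_nonneg _)]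
  refine (Finset.sum_le_sum fun j _ => Finset.sum_le_sum fun c _ =>
    (sq_le_sq.2 (by rw [abs_of_nonneg hx]; exact h j c) : _ ≤ x ^ 2)).trans_eq ?_
  simp [nontrivialCard, Finset.sum_mul]

end

section

/-! ### Logit equilibria and consistent states -/

variable {I : Type*} [Fintype I] [DecidableEq I]
variable {A : I → Type*} [∀ i, Fintype (A i)]

/-- The logit response of player `i` to an arbitrary profile of the opponents. -/
def logit (u : I → (∀ j, A j) → ℝ) (σ : ℝ) (i : I) (q : ∀ j : {j : I // j ≠ i}, A j → ℝ) :
    A i → ℝ :=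
  softmax fun c => utilityAction u i c q / σ

theorem smoothBR_mem_stdSimplex [∀ i, Nonempty (A i)] (u : I → (∀ j, A j) → ℝ) (σ : ℝ) {M : ℕ}
    (i : I) (b : Belief A M i) : smoothBR u σ i b ∈ stdSimplex ℝ (A i) :=
  softmax_mem_stdSimplex _

omit [Fintype I] [DecidableEq I] in
theorem Belief.prof_mem_stdSimplex {M : ℕ} {i : I} (b : Belief A M i) (j : {j : I // j ≠ i}) :
    b.prof j ∈ stdSimplex ℝ (A j) := mem_stdSimplex_of_gridSimplex (b j)

theorem State.strategy_mem_stdSimplex [∀ i, Nonempty (A i)] {u : I → (∀ j, A j) → ℝ} {σ : ℝ}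
    {M : ℕ} (z : State u σ M) (i : I) : z.strategy i ∈ stdSimplex ℝ (A i) := by
  rw [z.strategy_eq]; exact smoothBR_mem_stdSimplex u σ i _

/-- Every finite game has a logit equilibrium. -/
theorem exists_logit_equilibrium [∀ i, Nonempty (A i)] (u : I → (∀ j, A j) → ℝ) (σ : ℝ) :
    ∃ q : ∀ i, A i → ℝ, ∀ i, q i = logit u σ i fun j => q j := by
  -- The payoff formula is polynomial and makes sense for arbitrary vectors, and the softmax keeps
  -- the image bounded, so the fixed point theorem applies on the whole space without projecting to
  -- the simplices.
  let F : EuclideanSpace ℝ (Σ i, A i) → EuclideanSpace ℝ (Σ i, A i) := fun x =>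
    WithLp.toLp 2 fun y => logit u σ y.1 (fun j d => x ⟨j, d⟩) y.2
  have hF : ContDiff ℝ 1 F := by
    rw [contDiff_euclidean]
    rintro ⟨i, c⟩
    have hU : ∀ d : A i, ContDiff ℝ 1 fun x : EuclideanSpace ℝ (Σ i, A i) =>
        Real.exp (utilityAction u i d (fun (j : {j : I // j ≠ i}) e => x ⟨j, e⟩) / σ) := by
      intro d
      unfold utilityAction
      refine ContDiff.exp (ContDiff.div_const (ContDiff.sum fun a _ =>
        contDiff_const.mul (contDiff_prod fun j _ => ?_)) σ)
      fun_prop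
    exact (hU c).div (ContDiff.sum fun d _ => hU d) fun x => (sum_exp_pos _).ne'
  have hb : ∀ x, ‖F x‖ < Real.sqrt (Fintype.card (Σ i, A i)) + 1 := fun x => by
    refine lt_of_le_of_lt ?_ (lt_add_one _)
    rw [EuclideanSpace.norm_eq]
    refine Real.sqrt_le_sqrt ?_
    refine (Finset.sum_le_sum fun y _ => (?_ : ‖F x y‖ ^ 2 ≤ 1)).trans_eq (by simp)
    have hmem := softmax_mem_stdSimplex (α := A y.1)
      fun c => utilityAction u y.1 c (fun j d => x ⟨j, d⟩) / σ
    have h1 : F x y ≤ 1 := by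
      rw [← hmem.2]; exact Finset.single_le_sum (fun d _ => hmem.1 d) (Finset.mem_univ y.2)
    have h0 : 0 ≤ F x y := hmem.1 y.2
    rw [Real.norm_eq_abs, sq_abs]
    nlinarith
  obtain ⟨x, hx⟩ := exists_fixedPoint_of_contDiff hF hb
  exact ⟨fun i c => x ⟨i, c⟩, fun i => funext fun c =>
    (congrArg (fun y : EuclideanSpace ℝ (Σ i, A i) => y ⟨i, c⟩) hx).symm⟩

/-! ### Cardinality bounds and the existence of consistent states -/

omit [DecidableEq I] in
theorem card_le_maxActions (i : I) : Fintype.card (A i) ≤ maxActions A :=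
  Finset.le_sup (f := fun i => Fintype.card (A i)) (Finset.mem_univ i)

theorem card_mul_oppCard (i : I) :
    Fintype.card (A i) * oppCard A i = Fintype.card (∀ j, A j) := by
  rw [oppCard_eq_prod, Fintype.card_pi]
  exact (Fintype.prod_eq_mul_prod_subtype_ne (fun j => Fintype.card (A j)) i).symm

theorem card_le_maxProfiles [Nonempty I] : Fintype.card (∀ j, A j) ≤ maxProfiles A := by
  rw [← card_mul_oppCard (Classical.arbitrary I)]
  exact Finset.le_sup (f := fun i => Fintype.card (A i) * oppCard A i) (Finset.mem_univ _)

theorem oppCard_le_card [∀ i, Nonempty (A i)] (i : I) :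
    oppCard A i ≤ Fintype.card (∀ j, A j) := by
  rw [← card_mul_oppCard i]
  exact Nat.le_mul_of_pos_left _ Fintype.card_pos

theorem nontrivialCard_le_mul (i : I) :
    nontrivialCard A i ≤ Fintype.card I * maxActions A := by
  refine (Finset.sum_le_card_nsmul _ _ _ fun j _ => card_le_maxActions j.1).trans ?_
  rw [smul_eq_mul]
  refine Nat.mul_le_mul_right _ ((Finset.card_le_univ _).trans ?_)
  exact Fintype.card_subtype_le _

/-- With bad beliefs, at least two players have a choice. -/
theorem BadBeliefs.exists_two_le_card [∀ i, Nonempty (A i)] {u : I → (∀ j, A j) → ℝ} {σ τ : ℝ}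
    {M : ℕ} [NeZero M] (h : BadBeliefs u σ τ M) (hτ : 0 < τ) (i : I) :
    ∃ j, j ≠ i ∧ 2 ≤ Fintype.card (A j) := by
  by_contra! hcon
  obtain ⟨b', hb', -⟩ := h i (Classical.arbitrary _)
  have h0 := profDist_le_sqrt_mul (b'.prof_mem_stdSimplex)
    (fun j => smoothBR_mem_stdSimplex u σ j.1 (Classical.arbitrary (∀ j : {j : I // j ≠ i},
      Belief A M j.1) j)) le_rfl fun j c => by
    rw [profile_eq_of_card_le_one (b'.prof_mem_stdSimplex)
      (fun j => smoothBR_mem_stdSimplex u σ j.1 (Classical.arbitrary (∀ j : {j : I // j ≠ i},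
        Belief A M j.1) j)) j (Nat.le_of_lt_succ (hcon j j.2)), sub_self, abs_zero]
  rw [mul_zero] at h0
  linarith

/-- Some player has a choice, and some other player has one too. The numerical estimates below rely
on the resulting bound `4 ≤ maxProfiles A`. -/
theorem BadBeliefs.four_le_card [Nonempty I] [∀ i, Nonempty (A i)] {u : I → (∀ j, A j) → ℝ}
    {σ τ : ℝ} {M : ℕ} [NeZero M] (h : BadBeliefs u σ τ M) (hτ : 0 < τ) :
    4 ≤ Fintype.card (∀ j, A j) := by
  obtain ⟨j, -, hj⟩ := h.exists_two_le_card hτ (Classical.arbitrary I)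
  obtain ⟨k, hkj, hk⟩ := h.exists_two_le_card hτ j
  rw [Fintype.card_pi]
  calc 4 ≤ ∏ i ∈ {j, k}, Fintype.card (A i) := by
        rw [Finset.prod_pair hkj.symm]; nlinarith
    _ ≤ _ := Finset.prod_le_prod_of_subset_of_one_le' (Finset.subset_univ _)
        fun _ _ _ => Fintype.card_pos

theorem BadBeliefs.two_le_maxActions [Nonempty I] [∀ i, Nonempty (A i)]
    {u : I → (∀ j, A j) → ℝ} {σ τ : ℝ} {M : ℕ} [NeZero M] (h : BadBeliefs u σ τ M)
    (hτ : 0 < τ) : 2 ≤ maxActions A := by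
  obtain ⟨j, -, hj⟩ := h.exists_two_le_card hτ (Classical.arbitrary I)
  exact hj.trans (card_le_maxActions j)

/-- On a fine grid there is a consistent state: round a logit equilibrium. -/
theorem exists_consistent [Nonempty I] [∀ i, Nonempty (A i)] {u : I → (∀ j, A j) → ℝ}
    {ε σ τ : ℝ} {M : ℕ} [NeZero M] (hσ : 0 < σ) (hτ : 0 < τ)
    (hparam : ParameterConditions u ε σ τ M) (hbad : BadBeliefs u σ τ M) :
    ∃ z : State u σ M, z.Consistent τ := by
  have hM : 0 < M := NeZero.pos M
  have hM' : (0 : ℝ) < M := by exact_mod_cast hM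
  obtain ⟨q, hq⟩ := exists_logit_equilibrium u σ
  have hqs : ∀ i, q i ∈ stdSimplex ℝ (A i) := fun i => by
    rw [hq]; exact softmax_mem_stdSimplex _
  choose p hp using fun i => exists_gridSimplex_near hM (hqs i)
  let z : State u σ M := stateEquiv u σ M fun i j => p j
  refine ⟨z, fun i => ?_⟩
  have hn : (1 : ℝ) ≤ Fintype.card I := by exact_mod_cast Fintype.card_pos (α := I)
  have hm : (1 : ℝ) ≤ maxActions A := by
    exact_mod_cast (hbad.two_le_maxActions hτ).trans' one_le_two
  have hW : (4 : ℝ) ≤ maxProfiles A := by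
    exact_mod_cast (hbad.four_le_card hτ).trans card_le_maxProfiles
  have hKW : (nontrivialCard A i : ℝ) ≤ maxProfiles A := by
    exact_mod_cast (nontrivialCard_le_oppCard i).trans
      ((oppCard_le_card i).trans card_le_maxProfiles)
  have hKm : (nontrivialCard A i : ℝ) ≤ Fintype.card I * maxActions A := by
    exact_mod_cast nontrivialCard_le_mul i
  have hcardA : ∀ k, ((Finset.univ : Finset (A k)).card : ℝ) ≤ maxActions A := fun k => by
    exact_mod_cast card_le_maxActions k
  have hcardI : ∀ k : I, ((Finset.univ : Finset {j // j ≠ k}).card : ℝ) ≤ Fintype.card I :=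
    fun k => by exact_mod_cast Fintype.card_subtype_le _
  set N := maxPayoff u
  set m : ℝ := ((maxActions A : ℕ) : ℝ)
  set n : ℝ := ((Fintype.card I : ℕ) : ℝ)
  set W : ℝ := ((maxProfiles A : ℕ) : ℝ)
  set K : ℝ := ((nontrivialCard A i : ℕ) : ℝ)
  have hN : 0 ≤ N := maxPayoff_nonneg u
  -- A bound for the change of the logit exponents when the equilibrium is rounded: each of at most
  -- `n m` coordinates moves by at most `1 / M`.
  set η := N * (n * m * (1 / M)) / σ
  have hη : 0 ≤ η := by positivity
  have hu : ∀ (j : I) (c : A j),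
      |utilityAction u j c (z.belief j).prof / σ - utilityAction u j c (fun k => q k) / σ|
        ≤ η := fun j c => by
    rw [← sub_div, abs_div, abs_of_pos hσ]
    refine div_le_div_of_nonneg_right ((abs_utilityAction_sub_le u j c
      (fun k => (z.belief j).prof_mem_stdSimplex k) fun k => hqs k).trans ?_) hσ.le
    refine mul_le_mul_of_nonneg_left ?_ hN
    calc ∑ k : {k : I // k ≠ j}, ∑ d, |(z.belief j).prof k d - q k d|
        ≤ ∑ k : {k : I // k ≠ j}, m * (1 / M) := by
          refine Finset.sum_le_sum fun k _ => ?_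
          refine (Finset.sum_le_card_nsmul _ _ _ fun d _ => hp k.1 d).trans ?_
          rw [nsmul_eq_mul]
          exact mul_le_mul_of_nonneg_right (hcardA k) (by positivity)
      _ ≤ n * (m * (1 / M)) := by
          rw [Finset.sum_const, nsmul_eq_mul]
          exact mul_le_mul_of_nonneg_right (hcardI j) (by positivity)
      _ = n * m * (1 / M) := by ring
  have hcoord : ∀ (j : {j : I // j ≠ i}) (c : A j),
      |(z.belief i).prof j c - z.opp i j c| ≤ 1 / M + 2 * η := fun j c => by
    have h1 : |(z.belief i).prof j c - q j c| ≤ 1 / M := hp j.1 c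
    have h2 : |z.opp i j c - q j c| ≤ 2 * η := by
      rw [hq j.1]
      exact abs_softmax_sub_le (hu j.1) c
    calc _ ≤ |(z.belief i).prof j c - q j c| + |q j c - z.opp i j c| := abs_sub_le _ _ _
      _ ≤ _ := by rw [abs_sub_comm (q j c)]; linarith
  refine (profDist_le_sqrt_mul (fun j => (z.belief i).prof_mem_stdSimplex j)
    (fun j => z.strategy_mem_stdSimplex j.1) (by positivity) hcoord).trans ?_
  have hM2 := hparam.le_M
  change n * m / τ * (1 + Real.sqrt m / σ * N * W * n) ≤ M at hM2
  have h1 : Real.sqrt K ≤ n * m := by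
    refine Real.sqrt_le_iff.2 ⟨by positivity, hKm.trans ?_⟩
    nlinarith [mul_le_mul hn hm zero_le_one (by positivity)]
  -- From `K ≤ W` and `W ≥ 4` follows `√K ≤ W / 2`. Together with `h1` this matches the two summands
  -- in the lower bound on `M`.
  have h2 : Real.sqrt K * 2 ≤ Real.sqrt m * W * n := by
    have : Real.sqrt K ≤ W / 2 := Real.sqrt_le_iff.2 ⟨by positivity, by nlinarith⟩
    have h3 : 1 ≤ Real.sqrt m := Real.one_le_sqrt.2 hm
    have h4 : 1 ≤ Real.sqrt m * n := by nlinarith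
    nlinarith
  calc Real.sqrt K * (1 / M + 2 * η)
      = Real.sqrt K * (1 / M) + (Real.sqrt K * 2) * η := by ring
    _ ≤ n * m * (1 / M) + (Real.sqrt m * W * n) * η := by gcongr
    _ = τ * (n * m / τ * (1 + Real.sqrt m / σ * N * W * n)) / M := by
        simp only [η]; field_simp
    _ ≤ τ * M / M := by gcongr
    _ = τ := by field_simp

/-! ### Approximate equilibria -/

/-- The strategies of a consistent state are almost best responses. -/
theorem State.Consistent.utility_update_le [Nonempty I] [∀ i, Nonempty (A i)]
    {u : I → (∀ j, A j) → ℝ} {σ τ : ℝ} {M : ℕ} (hσ : 0 < σ) {z : State u σ M}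
    (hz : z.Consistent τ) (i : I) {p : A i → ℝ} (hp : p ∈ stdSimplex ℝ (A i)) :
    utility u i (Function.update z.strategy i p) ≤ utility u i z.strategy +
      (σ * Real.log (maxActions A) +
        2 * (maxPayoff u * (Real.sqrt (Fintype.card (∀ j, A j)) * τ))) := by
  set D := maxPayoff u * (Real.sqrt (Fintype.card (∀ j, A j)) * τ)
  set b := (z.belief i).prof
  have hD : ∀ c, |utilityAction u i c b - utilityAction u i c (z.opp i)| ≤ D := fun c => by
    have hb : ∀ j, b j ∈ stdSimplex ℝ (A j.1) := (z.belief i).prof_mem_stdSimplex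
    have ho : ∀ j, z.opp i j ∈ stdSimplex ℝ (A j.1) := fun j => z.strategy_mem_stdSimplex j.1
    refine (abs_utilityAction_sub_le u i c hb ho).trans
      (mul_le_mul_of_nonneg_left ((sum_abs_sub_le_sqrt_mul_profDist hb ho).trans ?_)
        (maxPayoff_nonneg u))
    refine mul_le_mul (Real.sqrt_le_sqrt ?_) (hz i) (Real.sqrt_nonneg _) (Real.sqrt_nonneg _)
    exact_mod_cast (nontrivialCard_le_oppCard i).trans (oppCard_le_card i)
  have hs := z.strategy_mem_stdSimplex i
  -- Against the belief, the logit response loses at most `σ log m`. Replacing the belief by the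
  -- true strategies costs `D` for the deviation and `D` for the response.
  have hbest : ∀ c, utilityAction u i c b ≤
      ∑ d, z.strategy i d * utilityAction u i d b + σ * Real.log (maxActions A) := fun c => by
    have h1 := sub_log_card_le_sum_softmax (fun c => utilityAction u i c b / σ) c
    have h2 : ∑ d, softmax (fun c => utilityAction u i c b / σ) d * (utilityAction u i d b / σ)
        = (∑ d, z.strategy i d * utilityAction u i d b) / σ := by
      rw [Finset.sum_div]
      refine Finset.sum_congr rfl fun d _ => ?_
      rw [z.strategy_eq, mul_div_assoc]
      rfl
    rw [h2, div_sub' hσ.ne', div_le_div_iff_of_pos_right hσ] at h1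
    have h3 : Real.log (Fintype.card (A i)) ≤ Real.log (maxActions A) :=
      Real.log_le_log (by exact_mod_cast Fintype.card_pos) (by exact_mod_cast card_le_maxActions i)
    nlinarith [mul_le_mul_of_nonneg_left h3 hσ.le]
  rw [utility_update, utility_eq_utilityAgainst, utilityAgainst_eq_sum, utilityAgainst_eq_sum]
  change ∑ c, p c * utilityAction u i c (z.opp i) ≤
    ∑ c, z.strategy i c * utilityAction u i c (z.opp i) + _
  have hbound : ∑ d, z.strategy i d * utilityAction u i d b ≤
      ∑ d, z.strategy i d * utilityAction u i d (z.opp i) + D := by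
    calc _ ≤ ∑ d, z.strategy i d * (utilityAction u i d (z.opp i) + D) := by
          refine Finset.sum_le_sum fun d _ => mul_le_mul_of_nonneg_left ?_ (hs.1 d)
          linarith [(abs_le.1 (hD d)).2]
      _ = _ := by
          simp only [mul_add, Finset.sum_add_distrib, ← Finset.sum_mul, hs.2, one_mul]
  calc ∑ c, p c * utilityAction u i c (z.opp i)
      ≤ ∑ c, p c * (∑ d, z.strategy i d * utilityAction u i d (z.opp i) +
        (σ * Real.log (maxActions A) + 2 * D)) := by
        refine Finset.sum_le_sum fun c _ => mul_le_mul_of_nonneg_left ?_ (hp.1 c)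
        linarith [(abs_le.1 (hD c)).1, hbest c]
    _ = _ := by rw [← Finset.sum_mul, hp.2, one_mul]

/-- If `2‖u‖ ≤ ε`, any two payoffs differ by at most `ε`. Otherwise multiply the condition on `τ` by
`2 log m` and use the bound on `σ`: the right side becomes at most `ε² ≤ 2‖u‖ε`, one factor `‖u‖`
cancels, and `W log m ≥ 2` leaves at most `ε / 2` for the belief error. The entropy loss takes the
other half. -/
theorem State.Consistent.isEpsNash [Nonempty I] [∀ i, Nonempty (A i)]
    {u : I → (∀ j, A j) → ℝ} {ε σ τ : ℝ} {M : ℕ} [NeZero M] (hε : 0 < ε) (hσ : 0 < σ)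
    (hτ : 0 < τ) (hparam : ParameterConditions u ε σ τ M) (hbad : BadBeliefs u σ τ M)
    (h : τ * (2 * Real.sqrt (Fintype.card (∀ i, A i) : ℝ) *
        (maxPayoff u ^ 2 * (maxProfiles A : ℝ))) ≤ ε * σ)
    {z : State u σ M} (hz : z.Consistent τ) : IsEpsNash u ε z.strategy := by
  have hs := z.strategy_mem_stdSimplex
  refine ⟨hs, fun i p hp => ?_⟩
  set N := maxPayoff u
  rcases le_or_gt (2 * N) ε with hN | hN
  · have h1 := abs_le.1 (abs_utility_le u i hs)
    have h2 := abs_le.1 (abs_utility_le u i (π := Function.update z.strategy i p) fun j => by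
      by_cases hj : j = i
      · subst hj; simpa using hp
      · simpa [hj] using hs j)
    linarith [h1.1, h2.2]
  · have hmain := hz.utility_update_le hσ i hp
    set s := Real.sqrt (Fintype.card (∀ i, A i) : ℝ)
    set l := Real.log (maxActions A)
    have hl : 1 / 2 ≤ l := by
      have : Real.log 2 ≤ l := Real.log_le_log two_pos
        (by exact_mod_cast hbad.two_le_maxActions hτ)
      linarith [Real.log_two_gt_d9]
    have hW : (4 : ℝ) ≤ maxProfiles A := by
      exact_mod_cast (hbad.four_le_card hτ).trans card_le_maxProfiles
    set W := (maxProfiles A : ℝ)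
    have hσl : σ * (2 * l) ≤ ε := hparam.sigma_le
    have hNpos : 0 < N := by linarith
    have hX : 0 ≤ N * (s * τ) := by positivity
    have hWl : 2 ≤ W * l := by nlinarith
    have h1 : N * (4 * (N * (s * τ)) * (W * l)) ≤ N * (2 * ε) := by
      calc N * (4 * (N * (s * τ)) * (W * l))
          = τ * (2 * s * (N ^ 2 * W)) * (2 * l) := by ring
        _ ≤ ε * σ * (2 * l) := by gcongr
        _ = ε * (σ * (2 * l)) := by ring
        _ ≤ ε * ε := by gcongr
        _ ≤ N * (2 * ε) := by nlinarith
    have h2 := le_of_mul_le_mul_left h1 hNpos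
    have h3 : 4 * (N * (s * τ)) ≤ ε := by nlinarith
    linarith

end

section

/-! ### Belief updates -/

section Update

variable {β : Type*} {g e : ℝ} {ψ : β → β → ℝ} {r : Prop} {b b' : β}

theorem updateProb_nonneg (hg0 : 0 ≤ g) (hg1 : g ≤ 1) (he0 : 0 ≤ e) (he1 : e ≤ 1)
    (hψ : 0 ≤ ψ b b') : 0 ≤ updateProb g e ψ r b b' := by
  have h1 : 0 ≤ 1 - g := sub_nonneg.2 hg1
  have h2 : 0 ≤ 1 - e := sub_nonneg.2 he1
  unfold updateProb
  split_ifs <;> positivity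

theorem updateProb_pos (hg0 : 0 < g) (hg1 : g ≤ 1) (he0 : 0 < e) (he1 : e ≤ 1)
    (hψ : 0 < ψ b b') : 0 < updateProb g e ψ r b b' := by
  have h1 : 0 ≤ 1 - g := sub_nonneg.2 hg1
  have h2 : 0 ≤ 1 - e := sub_nonneg.2 he1
  unfold updateProb
  split_ifs <;> positivity

theorem sum_updateProb [Fintype β] (hψ : ∑ b', ψ b b' = 1) :
    ∑ b', updateProb g e ψ r b b' = 1 := by
  classical
  unfold updateProb
  by_cases hr : r
  · simp [hr, Finset.sum_add_distrib, ← Finset.mul_sum, hψ]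
  · simp [hr, Finset.sum_add_distrib, ← Finset.mul_sum, hψ]

theorem updateProb_le_one [Fintype β] (hg0 : 0 ≤ g) (hg1 : g ≤ 1) (he0 : 0 ≤ e) (he1 : e ≤ 1)
    (hψ0 : ∀ b', 0 ≤ ψ b b') (hψ : ∑ b', ψ b b' = 1) : updateProb g e ψ r b b' ≤ 1 := by
  rw [← sum_updateProb (g := g) (e := e) (r := r) hψ]
  exact Finset.single_le_sum (f := fun b' => updateProb g e ψ r b b')
    (fun c _ => updateProb_nonneg hg0 hg1 he0 he1 (hψ0 c)) (Finset.mem_univ b')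

theorem updateProb_of_ne (hr : ¬ r) (h : b' ≠ b) : updateProb g e ψ r b b' = g * (e * ψ b b') := by
  simp [updateProb, hr, h]

theorem updateProb_zero_self (hr : ¬ r) : updateProb g 0 ψ r b b = 1 := by
  simp [updateProb, hr]

theorem updateProb_pos_of_reject (hg0 : 0 < g) (hg1 : g ≤ 1) (hψ : 0 < ψ b b') (hr : r) :
    0 < updateProb g e ψ r b b' := by
  have h1 : 0 ≤ 1 - g := sub_nonneg.2 hg1
  unfold updateProb
  split_ifs <;> positivity

theorem tendsto_updateProb {ι : Type*} {l : Filter ι} {x : ι → ℝ} (hx : Tendsto x l (𝓝 e)) :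
    Tendsto (fun t => updateProb g (x t) ψ r b b') l (𝓝 (updateProb g e ψ r b b')) := by
  unfold updateProb
  by_cases hr : r
  · simp only [hr, if_true]; exact tendsto_const_nhds
  · simp only [hr, if_false]
    exact tendsto_const_nhds.add (tendsto_const_nhds.mul
      ((hx.mul_const _).add ((tendsto_const_nhds.sub hx).mul_const _)))

end Update

theorem tendsto_rpow_nhdsGT_zero {a : ℝ} (ha : 0 < a) :
    Tendsto (fun ξ : ℝ => ξ ^ a) (𝓝[>] 0) (𝓝 0) := by
  have := (Real.continuousAt_rpow_const 0 a (Or.inr ha.le)).tendsto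
  rw [Real.zero_rpow ha.ne'] at this
  exact this.mono_left nhdsWithin_le_nhds

theorem abs_prod_sub_prod_le_one {ι : Type*} [Fintype ι] {x y : ι → ℝ}
    (hx : ∀ i, x i ∈ Icc (0 : ℝ) 1) (hy : ∀ i, y i ∈ Icc (0 : ℝ) 1) :
    |∏ i, x i - ∏ i, y i| ≤ 1 := by
  have h1 := Finset.prod_nonneg fun i (_ : i ∈ Finset.univ) => (hx i).1
  have h2 := Finset.prod_nonneg fun i (_ : i ∈ Finset.univ) => (hy i).1
  have h3 := Finset.prod_le_one (fun i (_ : i ∈ Finset.univ) => (hx i).1) fun i _ => (hx i).2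
  have h4 := Finset.prod_le_one (fun i (_ : i ∈ Finset.univ) => (hy i).1) fun i _ => (hy i).2
  rw [abs_le]; constructor <;> linarith

/-! ### The transition probabilities -/

variable {I : Type*} [Fintype I] [DecidableEq I]
variable {A : I → Type*} [∀ i, Fintype (A i)]
variable {u : I → (∀ j, A j) → ℝ} {σ τ : ℝ} {M : ℕ} {γ : I → ℝ} {f : I → ℝ → ℝ} {ubar : ℝ}
variable {T : ℝ → ℕ} {ψ : ∀ i, Belief A M i → Belief A M i → ℝ}

/-- The belief of player `i` is close to the strategies of the opponents. -/
def State.ConsistentFor (τ : ℝ) (z : State u σ M) (i : I) : Prop :=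
  profDist (z.belief i).prof (z.opp i) ≤ τ

/-- The probability of the move from `z` to `z'` if no test errs. -/
def errorFreeTransition (τ : ℝ) (γ : I → ℝ) (f : I → ℝ → ℝ)
    (ψ : ∀ i, Belief A M i → Belief A M i → ℝ) (ξ : ℝ) (z z' : State u σ M) : ℝ :=
  ∏ i, updateProb (γ i) (ξ ^ z.transformed f i) (ψ i) (¬ z.ConsistentFor τ i)
    (z.belief i) (z'.belief i)

theorem State.strategy_pos [∀ i, Nonempty (A i)] (z : State u σ M) (i : I) (c : A i) : 0 < z.strategy i c := by
  rw [z.strategy_eq]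
  exact div_pos (Real.exp_pos _) (sum_exp_pos _)

theorem sum_state_prod (g : ∀ i, Belief A M i → ℝ) :
    ∑ z : State u σ M, ∏ i, g i (z.belief i) = ∏ i, ∑ b, g i b := by
  rw [Fintype.prod_sum, ← (stateEquiv u σ M).sum_comp]
  rfl

theorem sum_transition [∀ i, DecidableEq (A i)] [∀ i, Nonempty (A i)]
    (hψ : ∀ i b, ∑ b', ψ i b b' = 1) (ξ : ℝ) (z : State u σ M) :
    ∑ z', transition u σ τ M γ f ubar T ψ ξ z z' = 1 := by
  unfold transition
  rw [Finset.sum_comm]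
  simp_rw [← Finset.mul_sum]
  rw [← sum_prod_weight_eq_one (prodWeight_mem_stdSimplex z.strategy_mem_stdSimplex).2
    (T (ξ ^ ubar))]
  refine Finset.sum_congr rfl fun a _ => ?_
  rw [sum_state_prod fun i b' => updateProb (γ i) (ξ ^ z.transformed f i) (ψ i)
    (Rejects τ (ξ ^ ubar) (z.belief i) (fun t (j : {j : I // j ≠ i}) => a t j.1)) (z.belief i) b',
    Finset.prod_eq_one fun i _ => sum_updateProb (hψ i _), mul_one]

theorem rpow_transformed_mem (hf : ∀ i x, 0 < f i x) {ξ : ℝ} (hξ : ξ ∈ Ioo (0 : ℝ) 1)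
    (z : State u σ M) (i : I) : ξ ^ z.transformed f i ∈ Ioo (0 : ℝ) 1 :=
  ⟨Real.rpow_pos_of_pos hξ.1 _, Real.rpow_lt_one hξ.1.le hξ.2 (hf _ _)⟩

theorem transition_pos [∀ i, DecidableEq (A i)] [∀ i, Nonempty (A i)]
    (hγ : ∀ i, 0 < γ i ∧ γ i ≤ 1) (hf : ∀ i x, 0 < f i x)
    (hψ : ∀ i b b', 0 < ψ i b b') {ξ : ℝ} (hξ : ξ ∈ Ioo (0 : ℝ) 1) (z z' : State u σ M) :
    0 < transition u σ τ M γ f ubar T ψ ξ z z' := by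
  refine Finset.sum_pos (fun a _ => mul_pos
    (Finset.prod_pos fun t _ => Finset.prod_pos fun i _ => z.strategy_pos i _)
    (Finset.prod_pos fun i _ => ?_)) Finset.univ_nonempty
  have := rpow_transformed_mem hf hξ z i
  exact updateProb_pos (hγ i).1 (hγ i).2 this.1 this.2.le (hψ i _ _)

/-- Sufficient samples are non-empty if somebody can have an inconsistent belief. -/
theorem BadBeliefs.sample_pos [∀ i, Nonempty (A i)] [Nonempty I] [NeZero M]
    (h : BadBeliefs u σ τ M) {α : ℝ} (hα : α ∈ Ioo (0 : ℝ) 1) {T : ℕ} (hT : SufficientSample u σ τ M α T) : 0 < T := by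
  let i := Classical.arbitrary I
  let b : ∀ j : {j : I // j ≠ i}, Belief A M j.1 := Classical.arbitrary _
  obtain ⟨b', hb', -⟩ := h i b
  rw [profDist_comm] at hb'
  have h1 := hT i b' b hb'
  have h2 : 0 < Real.log (2 / α) := Real.log_pos (by rw [lt_div_iff₀ hα.1]; linarith [hα.2])
  have h3 := sub_pos.2 hb'
  have h4 : (0 : ℝ) < oppCard A i := by exact_mod_cast oppCard_pos i
  have h5 : (0 : ℝ) < T := lt_of_lt_of_le (by positivity) h1
  exact_mod_cast h5

/-- Up to the probability of an error, every test finds out whether the belief is consistent. -/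
theorem abs_transition_sub_le [∀ i, DecidableEq (A i)] [∀ i, Nonempty (A i)] [Nonempty I] [NeZero M]
    (hγ : ∀ i, 0 < γ i ∧ γ i ≤ 1)
    (hf : ∀ i x, 0 < f i x) (hψ0 : ∀ i b b', 0 ≤ ψ i b b') (hψ : ∀ i b, ∑ b', ψ i b b' = 1)
    (hbad : BadBeliefs u σ τ M)
    (hT : ∀ α ∈ Ioo (0 : ℝ) 1, SufficientSample u σ τ M α (T α)) (hu : 0 < ubar)
    {ξ : ℝ} (hξ : ξ ∈ Ioo (0 : ℝ) 1) (z z' : State u σ M) :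
    |transition u σ τ M γ f ubar T ψ ξ z z' - errorFreeTransition τ γ f ψ ξ z z'| ≤
      (∑ i, (Fintype.card (Σ j : {j : I // j ≠ i}, A j) : ℝ)) * ξ ^ ubar := by
  classical
  set α := ξ ^ ubar
  have hα : α ∈ Ioo (0 : ℝ) 1 := ⟨Real.rpow_pos_of_pos hξ.1 _, Real.rpow_lt_one hξ.1.le hξ.2 hu⟩
  have hTpos := hbad.sample_pos hα (hT α hα)
  have hs := z.strategy_mem_stdSimplex
  set w : (∀ j, A j) → ℝ := fun x => ∏ j, z.strategy j (x j)
  have hw : w ∈ stdSimplex ℝ (∀ j, A j) := prodWeight_mem_stdSimplex hs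
  let rej : I → (Fin (T α) → ∀ i, A i) → Prop := fun i a =>
    Rejects τ α (z.belief i) (fun t (j : {j : I // j ≠ i}) => a t j.1)
  have hmem : ∀ i (r : Prop), updateProb (γ i) (ξ ^ z.transformed f i) (ψ i) r
      (z.belief i) (z'.belief i) ∈ Icc (0 : ℝ) 1 := fun i r => by
    have he := rpow_transformed_mem hf hξ z i
    exact ⟨updateProb_nonneg (hγ i).1.le (hγ i).2 he.1.le he.2.le (hψ0 i _ _),
      updateProb_le_one (hγ i).1.le (hγ i).2 he.1.le he.2.le (hψ0 i _) (hψ i _)⟩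
  -- On samples without an error the two products agree; on the others both lie in `[0, 1]`.
  have hdiff : |transition u σ τ M γ f ubar T ψ ξ z z' - errorFreeTransition τ γ f ψ ξ z z'| ≤
      sampleProb w (T α) (fun a => ∃ i, ¬ (rej i a ↔ ¬ z.ConsistentFor τ i)) := by
    have h1 : errorFreeTransition τ γ f ψ ξ z z' =
        ∑ a : Fin (T α) → ∀ i, A i, (∏ t, w (a t)) * errorFreeTransition τ γ f ψ ξ z z' := by
      rw [← Finset.sum_mul, sum_prod_weight_eq_one hw.2, one_mul]
    rw [h1, transition, ← Finset.sum_sub_distrib]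
    refine (Finset.abs_sum_le_sum_abs _ _).trans (Finset.sum_le_sum fun a _ => ?_)
    rw [← mul_sub, abs_mul, abs_of_nonneg (Finset.prod_nonneg fun t _ => hw.1 _)]
    refine mul_le_mul_of_nonneg_left ?_ (Finset.prod_nonneg fun t _ => hw.1 _)
    split_ifs with h
    · exact abs_prod_sub_prod_le_one (fun i => hmem i _) fun i => hmem i _
    · push Not at h
      have h2 : ∀ i, rej i a = ¬ z.ConsistentFor τ i := fun i => propext (h i)
      rw [sub_eq_zero.2, abs_zero]
      exact Finset.prod_congr rfl fun i _ => congrArg (fun r => updateProb (γ i)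
        (ξ ^ z.transformed f i) (ψ i) r (z.belief i) (z'.belief i)) (h2 i)
  refine hdiff.trans ((sampleProb_exists_le hw.1 fun i a =>
    ¬ (rej i a ↔ ¬ z.ConsistentFor τ i)).trans ?_)
  rw [Finset.sum_mul]
  refine Finset.sum_le_sum fun i _ =>
    sampleProb_test_error_le hs hTpos hα i (z.belief i) fun hd => ?_
  have he : (fun j : {j : I // j ≠ i} => z.strategy j) =
      fun j : {j : I // j ≠ i} => smoothBR u σ j.1 (z.belief j.1) :=
    funext fun j => z.strategy_eq j.1
  rw [he] at hd ⊢
  exact hT α hα i (z.belief i) (fun j => z.belief j.1) hd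

/-! ### Exit rates -/

open scoped Classical in
/-- The order of the probability of leaving the state `z`. -/
def exitOrder [Nonempty I] (τ : ℝ) (f : I → ℝ → ℝ) (z : State u σ M) : ℝ :=
  if z.Consistent τ then z.minTransformed f else 0

/-- The moves with a rate of the maximal order: from a consistent state, a player with the least
transformed utility changes the belief; from an inconsistent one, all players with inconsistent
beliefs may change them. -/
def DominantMove [Nonempty I] (τ : ℝ) (f : I → ℝ → ℝ) (z z' : State u σ M) : Prop :=
  (z.Consistent τ → ∃ i, z.transformed f i = z.minTransformed f ∧
    ∀ j, j ≠ i → z'.belief j = z.belief j) ∧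
  (¬ z.Consistent τ → ∀ i, z.ConsistentFor τ i → z'.belief i = z.belief i)

/-- The strategy and the belief of player `i` together form a mixed profile, to which the bound
`ubar` applies; positivity of the `f_j` isolates one summand. -/
theorem transformed_lt [∀ i, Nonempty (A i)] (hf : ∀ i x, 0 < f i x)
    (hubar : ∀ π : ∀ i, A i → ℝ, (∀ i, π i ∈ stdSimplex ℝ (A i)) →
      ∑ i, f i (utility u i π) < ubar) (z : State u σ M) (i : I) :
    z.transformed f i < ubar := by
  refine lt_of_le_of_lt ?_ (hubar ((Equiv.piSplitAt i (fun j => A j → ℝ)).symm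
    (z.strategy i, (z.belief i).prof)) fun j => ?_)
  · exact Finset.single_le_sum (f := fun j => f j (utility u j
      ((Equiv.piSplitAt i (fun j => A j → ℝ)).symm (z.strategy i, (z.belief i).prof))))
      (fun j _ => (hf j _).le) (Finset.mem_univ i)
  · by_cases h : j = i
    · subst h
      simpa [Equiv.piSplitAt] using z.strategy_mem_stdSimplex j
    · simpa [Equiv.piSplitAt, h] using (z.belief i).prof_mem_stdSimplex ⟨j, h⟩

/-- No test rejects, so a player `i` who changes the belief contributes a factor `γ_i ψ_i ξ ^ f_i`,
whose exponent is at least the minimum. All other factors converge, and to `1` for players who keep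
their belief. -/
theorem tendsto_rpow_mul_errorFree_of_consistent [Nonempty I] (hγ : ∀ i, 0 < γ i ∧ γ i ≤ 1)
    (hf : ∀ i x, 0 < f i x) (hψ0 : ∀ i b b', 0 < ψ i b b') {z z' : State u σ M} (hzz' : z ≠ z')
    (hz : z.Consistent τ) :
    ∃ l, Tendsto (fun ξ : ℝ => ξ ^ (-z.minTransformed f) * errorFreeTransition τ γ f ψ ξ z z')
      (𝓝[>] 0) (𝓝 l) ∧ ((∃ i, z.transformed f i = z.minTransformed f ∧
        ∀ j, j ≠ i → z'.belief j = z.belief j) → 0 < l) := by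
  obtain ⟨i, hi⟩ : ∃ i, z'.belief i ≠ z.belief i := by
    by_contra! h
    exact hzz' ((stateEquiv u σ M).symm.injective (funext h).symm)
  have hr : ∀ j, ¬ ¬ z.ConsistentFor τ j := fun j => not_not.2 (hz j)
  have hmin : z.minTransformed f ≤ z.transformed f i := Finset.inf'_le _ (Finset.mem_univ i)
  set ρ := z.minTransformed f
  have hpow : ∃ l, Tendsto (fun ξ : ℝ => ξ ^ (z.transformed f i - ρ)) (𝓝[>] 0) (𝓝 l) ∧
      (z.transformed f i = ρ → 0 < l) := by
    rcases hmin.eq_or_lt with h | h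
    · exact ⟨1, by simp [← h], fun _ => one_pos⟩
    · exact ⟨0, tendsto_rpow_nhdsGT_zero (sub_pos.2 h), fun h' => absurd h' h.ne'⟩
  obtain ⟨l, hl, hlpos⟩ := hpow
  have hrest : ∀ j, Tendsto (fun ξ : ℝ => updateProb (γ j) (ξ ^ z.transformed f j) (ψ j)
      (¬ z.ConsistentFor τ j) (z.belief j) (z'.belief j)) (𝓝[>] 0)
      (𝓝 (updateProb (γ j) 0 (ψ j) (¬ z.ConsistentFor τ j) (z.belief j) (z'.belief j))) :=
    fun j => tendsto_updateProb (tendsto_rpow_nhdsGT_zero (hf _ _))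
  refine ⟨(γ i * ψ i (z.belief i) (z'.belief i) * l) * ∏ j ∈ Finset.univ.erase i,
    updateProb (γ j) 0 (ψ j) (¬ z.ConsistentFor τ j) (z.belief j) (z'.belief j), ?_, ?_⟩
  · refine ((hl.const_mul _).mul (tendsto_finsetProd _ fun j _ => hrest j)).congr' ?_
    filter_upwards [self_mem_nhdsWithin] with ξ (hξ : 0 < ξ)
    rw [errorFreeTransition, ← Finset.mul_prod_erase _ _ (Finset.mem_univ i),
      updateProb_of_ne (hr i) hi, sub_eq_neg_add, Real.rpow_add hξ]
    ring
  · rintro ⟨k, hk, hsame⟩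
    have hik : i = k := by
      by_contra h
      exact hi (hsame i h)
    subst hik
    refine mul_pos (mul_pos (mul_pos (hγ i).1 (hψ0 i _ _)) (hlpos hk))
      (Finset.prod_pos fun j hj => ?_)
    rw [hsame j (Finset.ne_of_mem_erase hj), updateProb_zero_self (hr j)]
    exact one_pos

theorem tendsto_errorFree (hγ : ∀ i, 0 < γ i ∧ γ i ≤ 1) (hf : ∀ i x, 0 < f i x)
    (hψ0 : ∀ i b b', 0 < ψ i b b') (z z' : State u σ M) :
    ∃ l, Tendsto (fun ξ : ℝ => errorFreeTransition τ γ f ψ ξ z z') (𝓝[>] 0) (𝓝 l) ∧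
      ((∀ i, z.ConsistentFor τ i → z'.belief i = z.belief i) → 0 < l) := by
  refine ⟨_, tendsto_finsetProd _ fun i _ =>
    tendsto_updateProb (tendsto_rpow_nhdsGT_zero (hf i _)), fun h => Finset.prod_pos fun i _ => ?_⟩
  by_cases hi : z.ConsistentFor τ i
  · rw [h i hi, updateProb_zero_self (not_not.2 hi)]
    exact one_pos
  · exact updateProb_pos_of_reject (hγ i).1 (hγ i).2 (hψ0 i _ _) hi

/-- The error-free chain has the required limits, and the error `O(ξ ^ ubar)` vanishes even after
rescaling since the exit order is below `ubar`. -/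
theorem tendsto_rpow_mul_transition [∀ i, DecidableEq (A i)] [∀ i, Nonempty (A i)] [Nonempty I]
    [NeZero M] (hγ : ∀ i, 0 < γ i ∧ γ i ≤ 1)
    (hf : ∀ i x, 0 < f i x) (hψ0 : ∀ i b b', 0 < ψ i b b') (hψ : ∀ i b, ∑ b', ψ i b b' = 1)
    (hbad : BadBeliefs u σ τ M)
    (hT : ∀ α ∈ Ioo (0 : ℝ) 1, SufficientSample u σ τ M α (T α))
    (hubar : ∀ π : ∀ i, A i → ℝ, (∀ i, π i ∈ stdSimplex ℝ (A i)) →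
      ∑ i, f i (utility u i π) < ubar) {z z' : State u σ M} (hzz' : z ≠ z') :
    ∃ l, Tendsto (fun ξ : ℝ => ξ ^ (-exitOrder τ f z) *
      transition u σ τ M γ f ubar T ψ ξ z z') (𝓝[>] 0) (𝓝 l) ∧
      (DominantMove τ f z z' → 0 < l) := by
  have hi₀ := transformed_lt hf hubar z (Classical.arbitrary I)
  have hu : 0 < ubar := (hf _ _).trans hi₀
  have hlt : exitOrder τ f z < ubar := by
    unfold exitOrder
    split_ifs
    · exact (Finset.inf'_le _ (Finset.mem_univ _)).trans_lt hi₀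
    · exact hu
  have hmain : ∃ l, Tendsto (fun ξ : ℝ => ξ ^ (-exitOrder τ f z) *
      errorFreeTransition τ γ f ψ ξ z z') (𝓝[>] 0) (𝓝 l) ∧
      (DominantMove τ f z z' → 0 < l) := by
    by_cases hz : z.Consistent τ
    · obtain ⟨l, hl, hl'⟩ := tendsto_rpow_mul_errorFree_of_consistent hγ hf hψ0 hzz' hz
      exact ⟨l, by simpa [exitOrder, hz] using hl, fun h => hl' (h.1 hz)⟩
    · obtain ⟨l, hl, hl'⟩ := tendsto_errorFree (τ := τ) hγ hf hψ0 z z'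
      exact ⟨l, by simpa [exitOrder, hz] using hl, fun h => hl' (h.2 hz)⟩
  obtain ⟨l, hl, hl'⟩ := hmain
  refine ⟨l, ?_, hl'⟩
  set C := ∑ i, (Fintype.card (Σ j : {j : I // j ≠ i}, A j) : ℝ)
  have herr : Tendsto (fun ξ : ℝ => ξ ^ (-exitOrder τ f z) *
      (transition u σ τ M γ f ubar T ψ ξ z z' - errorFreeTransition τ γ f ψ ξ z z'))
      (𝓝[>] 0) (𝓝 0) := by
    have h0 := (tendsto_rpow_nhdsGT_zero (sub_pos.2 hlt)).const_mul C
    rw [mul_zero] at h0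
    refine squeeze_zero_norm' ?_ h0
    filter_upwards [Ioo_mem_nhdsGT (zero_lt_one' ℝ)] with ξ hξ
    rw [norm_mul, Real.norm_eq_abs, Real.norm_eq_abs,
      abs_of_nonneg (Real.rpow_nonneg hξ.1.le _), sub_eq_neg_add ubar, Real.rpow_add hξ.1]
    calc _ ≤ ξ ^ (-exitOrder τ f z) * (C * ξ ^ ubar) :=
          mul_le_mul_of_nonneg_left (abs_transition_sub_le hγ hf (fun i b b' => (hψ0 i b b').le)
            hψ hbad hT hu hξ z z') (Real.rpow_nonneg hξ.1.le _)
      _ = _ := by ring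
  have := hl.add herr
  rw [add_zero] at this
  refine this.congr fun ξ => ?_
  ring

/-- Dominant moves lead from every state to every other one. -/
theorem reflTransGen_dominantMove [Nonempty I] (hbad : BadBeliefs u σ τ M) (f : I → ℝ → ℝ)
    (z z' : State u σ M) : Relation.ReflTransGen (DominantMove τ f) z z' := by
  -- A player who may move alone at the dominant rate: one with the least transformed utility if the
  -- state is consistent, one with an inconsistent belief otherwise.
  have hchoice : ∃ i, (z.Consistent τ → z.transformed f i = z.minTransformed f) ∧
      (¬ z.Consistent τ → ¬ z.ConsistentFor τ i) := by
    by_cases hz : z.Consistent τ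
    · obtain ⟨i, -, hi⟩ := Finset.exists_mem_eq_inf' Finset.univ_nonempty (z.transformed f)
      exact ⟨i, fun _ => hi.symm, fun h => absurd hz h⟩
    · obtain ⟨i, hi⟩ := not_forall.1 hz
      exact ⟨i, fun h => absurd h hz, fun _ => hi⟩
  obtain ⟨i, hi, hi'⟩ := hchoice
  obtain ⟨b', hb', hbr⟩ := hbad i fun j => z.belief j
  let y : State u σ M := stateEquiv u σ M (Function.update z.belief i b')
  have hyi : y.belief i = b' := Function.update_self ..
  have hyj : ∀ j, j ≠ i → y.belief j = z.belief j := fun j hj => Function.update_of_ne hj ..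
  -- The new belief of `i` is far from the unchanged strategies of the opponents, and the new
  -- strategy of `i` is far from what each opponent still believes about `i`.
  have hy : ∀ j, ¬ y.ConsistentFor τ j := fun j => by
    refine not_le.2 ?_
    by_cases hj : j = i
    · subst hj
      rw [hyi]
      refine hb'.trans_eq (congrArg _ (funext fun k => ?_))
      change _ = y.strategy k
      rw [y.strategy_eq, hyj k k.2]
    · rw [hyj j hj]
      refine (hbr ⟨j, hj⟩).trans_le (le_trans (le_of_eq ?_)
        (stratDist_le_profDist _ _ ⟨i, Ne.symm hj⟩))
      rw [stratDist_comm]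
      change _ = stratDist _ (y.strategy i)
      rw [y.strategy_eq, hyi]
      rfl
  have h1 : DominantMove τ f z y := by
    refine ⟨fun hz => ⟨i, hi hz, hyj⟩, fun hz j hj => hyj j ?_⟩
    rintro rfl
    exact hi' hz hj
  have h2 : DominantMove τ f y z' :=
    ⟨fun h => absurd (h i) (hy i), fun _ j hj => absurd hj (hy j)⟩
  exact (Relation.ReflTransGen.single h1).tail h2

/-- Inconsistent states have exit order zero and consistent ones a positive order, so the existence
of `z₀` excludes inconsistent maximizers. -/
theorem forall_exitOrder_le_iff [Nonempty I] (hf : ∀ i x, 0 < f i x) {z₀ : State u σ M}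
    (hz₀ : z₀.Consistent τ) (z : State u σ M) :
    (∀ w : State u σ M, exitOrder τ f w ≤ exitOrder τ f z) ↔ z.Consistent τ ∧
      IsGreatest ((fun z' : State u σ M => z'.minTransformed f) '' {z' | z'.Consistent τ})
        (z.minTransformed f) := by
  have hpos : ∀ w : State u σ M, 0 < w.minTransformed f := fun w =>
    (Finset.lt_inf'_iff (f := w.transformed f) Finset.univ_nonempty).2 fun i _ => hf _ _
  constructor
  · intro h
    have hz : z.Consistent τ := by
      by_contra hz
      have := h z₀
      rw [exitOrder, exitOrder, if_pos hz₀, if_neg hz] at this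
      exact absurd this (not_le.2 (hpos z₀))
    refine ⟨hz, ⟨z, hz, rfl⟩, ?_⟩
    rintro _ ⟨w, hw, rfl⟩
    have := h w
    rwa [exitOrder, exitOrder, if_pos hz, if_pos (show w.Consistent τ from hw)] at this
  · rintro ⟨hz, -, hub⟩ w
    rw [exitOrder, exitOrder, if_pos hz]
    split_ifs with hw
    · exact hub ⟨w, hw, rfl⟩
    · exact (hpos z).le

end

end HypothesisLearning

end

/-! ### The main theorem -/

theorem theorem1 {I : Type*} [Fintype I] [DecidableEq I] [Nonempty I]
    {A : I → Type*} [∀ i, Fintype (A i)] [∀ i, DecidableEq (A i)] [∀ i, Nonempty (A i)]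
    (u : I → (∀ j, A j) → ℝ)
    (ε σ τ : ℝ) (M : ℕ) (hε : 0 < ε) (hσ : 0 < σ) (hτ : 0 < τ) (hM : 0 < M)
    (γ : I → ℝ) (hγ : ∀ i, 0 < γ i ∧ γ i ≤ 1)
    (f : I → ℝ → ℝ) (hf : ∀ i, Monotone (f i)) (hfpos : ∀ i x, 0 < f i x)
    (ubar : ℝ)
    (hubar : ∀ π : ∀ i, A i → ℝ, (∀ i, π i ∈ stdSimplex ℝ (A i)) →
      ∑ i, f i (HypothesisLearning.utility u i π) < ubar)
    (T : ℝ → ℕ)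
    (hT : ∀ α ∈ Set.Ioo (0 : ℝ) 1, HypothesisLearning.SufficientSample u σ τ M α (T α))
    (lam : ℝ) (hlam : 0 < lam)
    (ψ : ∀ i, HypothesisLearning.Belief A M i → HypothesisLearning.Belief A M i → ℝ)
    (hψ : ∀ i b, ∑ b', ψ i b b' = 1) (hψlam : ∀ i b b', lam ≤ ψ i b b')
    (hparam : HypothesisLearning.ParameterConditions u ε σ τ M)
    (hbad : HypothesisLearning.BadBeliefs u σ τ M) :
    -- for every `ξ` the chain has a unique stationary distribution
    (∀ ξ ∈ Set.Ioo (0 : ℝ) 1, ∃! μ : HypothesisLearning.State u σ M → ℝ,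
      HypothesisLearning.IsStationary
        (HypothesisLearning.transition u σ τ M γ f ubar T ψ ξ) μ) ∧
    -- the stationary probability of every state converges as `ξ → 0`
    (∀ μ : ℝ → HypothesisLearning.State u σ M → ℝ,
      HypothesisLearning.IsStationaryFamily
        (HypothesisLearning.transition u σ τ M γ f ubar T ψ) μ →
      ∀ z, ∃ l : ℝ, Filter.Tendsto (fun ξ => μ ξ z) (nhdsWithin 0 (Set.Ioi 0)) (nhds l)) ∧
    -- the stochastically stable states are the consistent max-min states
    {z : HypothesisLearning.State u σ M | HypothesisLearning.StochasticallyStable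
        (HypothesisLearning.transition u σ τ M γ f ubar T ψ) z} =
      {z | z.Consistent τ ∧
        IsGreatest
          ((fun z' : HypothesisLearning.State u σ M => z'.minTransformed f) ''
            {z' | z'.Consistent τ})
          (z.minTransformed f)} ∧
    -- the stochastically stable states are approximate equilibria
    (τ * (2 * Real.sqrt (Fintype.card (∀ i, A i) : ℝ) *
        (HypothesisLearning.maxPayoff u ^ 2 * (HypothesisLearning.maxProfiles A : ℝ))) ≤ ε * σ →
      ∀ z : HypothesisLearning.State u σ M,
        HypothesisLearning.StochasticallyStable
          (HypothesisLearning.transition u σ τ M γ f ubar T ψ) z →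
        HypothesisLearning.IsEpsNash u ε z.strategy) := by
  have : NeZero M := ⟨hM.ne'⟩
  classical
  have hψpos : ∀ i b b', 0 < ψ i b b' := fun i b b' => hlam.trans_le (hψlam i b b')
  obtain ⟨z₀, hz₀⟩ := HypothesisLearning.exists_consistent hσ hτ hparam hbad
  have : Nonempty (HypothesisLearning.State u σ M) := ⟨z₀⟩
  set P := HypothesisLearning.transition u σ τ M γ f ubar T ψ
  have hPpos : ∀ ξ ∈ Set.Ioo (0 : ℝ) 1, ∀ z z', 0 < P ξ z z' := fun ξ hξ =>
    HypothesisLearning.transition_pos hγ hfpos hψpos hξ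
  have hPsum : ∀ ξ ∈ Set.Ioo (0 : ℝ) 1, ∀ z, ∑ z', P ξ z z' = 1 := fun ξ _ =>
    HypothesisLearning.sum_transition hψ ξ
  have hunique : ∀ ξ ∈ Set.Ioo (0 : ℝ) 1, ∃! μ, HypothesisLearning.IsStationary (P ξ) μ :=
    fun ξ hξ => HypothesisLearning.existsUnique_isStationary (hPpos ξ hξ) (hPsum ξ hξ)
  have hlim : ∀ μ, HypothesisLearning.IsStationaryFamily P μ → ∀ z,
      ∃ l, Filter.Tendsto (fun ξ => μ ξ z) (nhdsWithin 0 (Set.Ioi 0)) (nhds l) ∧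
        (0 < l ↔ ∀ w, HypothesisLearning.exitOrder τ f w ≤ HypothesisLearning.exitOrder τ f z) :=
    fun μ hμ => HypothesisLearning.exists_tendsto_stationary
      (fun ξ hξ z z' => (hPpos ξ hξ z z').le) hPsum _ _
      (fun z z' h => HypothesisLearning.tendsto_rpow_mul_transition hγ hfpos hψpos hψ hbad hT
        hubar h)
      (HypothesisLearning.reflTransGen_dominantMove hbad f) hμ
  have hstable : ∀ z, HypothesisLearning.StochasticallyStable P z ↔ z.Consistent τ ∧
      IsGreatest ((fun z' : HypothesisLearning.State u σ M => z'.minTransformed f) ''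
        {z' | z'.Consistent τ}) (z.minTransformed f) := fun z => by
    rw [← HypothesisLearning.forall_exitOrder_le_iff hfpos hz₀]
    constructor
    · rintro ⟨μ, hμ, l, hl, hlt⟩
      obtain ⟨l', hlt', hl'⟩ := hlim μ hμ z
      exact hl'.1 (tendsto_nhds_unique hlt hlt' ▸ hl)
    · intro h
      -- The values of the family outside `(0, 1)` are arbitrary and do not affect the limit at `0`
      -- from the right.
      choose! μ hμ _ using hunique
      obtain ⟨l, hlt, hl⟩ := hlim μ hμ z
      exact ⟨μ, hμ, l, hl.2 h, hlt⟩
  refine ⟨hunique, fun μ hμ z => ?_, Set.ext hstable, fun h z hz => ?_⟩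
  · obtain ⟨l, hl, -⟩ := hlim μ hμ z
    exact ⟨l, hl⟩
  · exact ((hstable z).1 hz).1.isEpsNash hε hσ hτ hparam hbad h
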